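/- Let $N \ge 2$ be an integer and let $x \in \mathbb R$. On $V = (\mathbb C^3)^{\otimes N}$ consider the spin-one XXZ Hamiltonian $$H = \sum_{j=1}^N \Big( \sum_{a=1}^3 J_a \big( s_j^a s_{j+1}^a + 2 (s_j^a)^2 \big) - \sum_{a,b=1}^3 A_{ab}\, s_j^a s_j^b s_{j+1}^a s_{j+1}^b \Big),$$ where $s_j^a$ acts at site $j$ as the spin-one matrix $$s^1 = \tfrac{1}{\sqrt 2}\begin{pmatrix} 0&1&0\\1&0&1\\0&1&0\end{pmatrix},\quad s^2 = \tfrac{1}{\sqrt 2}\begin{pmatrix} 0&-i&0\\i&0&-i\\0&i&0\end{pmatrix},\quad s^3 = \begin{pmatrix} 1&0&0\\0&0&0\\0&0&-1\end{pmatrix},$$ and where $J_1=J_2=1$, $J_3=\tfrac12(x^2-2)$, $A_{ab}=A_{ba}$, $A_{aa}=J_a$, $A_{12}=1$, $A_{13}=A_{23}=x-1$. The operators $s_{N+1}^a$ are given by one of the following boundary conditions: the diagonal twist $s_{N+1}^1=-s_1^1$, $s_{N+1}^2=-s_1^2$, $s_{N+1}^3=s_1^3$, or the anti-diagonal twist $s_{N+1}^1=s_1^1$,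 $s_{N+1}^2=-s_1^2$, $s_{N+1}^3=-s_1^3$. Let $M=\sum_{j=1}^N s_j^3$ be the total magnetisation and let $F = \begin{pmatrix} 0&0&1\\0&1&0\\1&0&0\end{pmatrix}^{\otimes N}$ be the spin-flip operator. (i) For the anti-diagonal twist, $H$ preserves the eigenspaces of $(-1)^M$ for the eigenvalues $1$ and $-1$, and the non-zero parts of the spectra of the restrictions of $H$ to these two eigenspaces coincide, including degeneracies: every $E \neq 0$ has an eigenspace of the same dimension (possibly $0$) for the two restrictions. (ii) For the diagonal twist, $H$ preserves the eigenspaces of $F$ for the eigenvalues $1$ and $-1$, and the non-zero parts of the spectra of the restrictions of $H$ to these two eigenspaces coincide, including degeneracies, in the same sense. -/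

import Mathlib

namespace SpinOneXXZ

noncomputable section

/-- Operators on the Hilbert space `(ℂ³)^{⊗N}`, as matrices in the canonical basis. A basis state
`|σ₁ ⋯ σ_N⟩` is a configuration `σ : Fin N → Fin 3`, where the values `0, 1, 2` of `σ j` stand for
spin up, spin zero and spin down at the site `j`. Sites are numbered from `0`. -/
abbrev Op (N : ℕ) : Type := Matrix (Fin N → Fin 3) (Fin N → Fin 3) ℂ

/-- The spin-one matrices `s¹, s², s³`, indexed by `0, 1, 2`. -/
def spin : Fin 3 → Matrix (Fin 3) (Fin 3) ℂ :=
  ![((1 / Real.sqrt 2 : ℝ) : ℂ) • !![0, 1, 0; 1, 0, 1; 0, 1, 0],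
    ((1 / Real.sqrt 2 : ℝ) : ℂ) •
      !![0, -Complex.I, 0; Complex.I, 0, -Complex.I; 0, Complex.I, 0],
    !![1, 0, 0; 0, 0, 0; 0, 0, -1]]

/-- The tensor product `A₁ ⊗ ⋯ ⊗ A_N` of one-site operators. -/
def tensorOp {N : ℕ} (A : Fin N → Matrix (Fin 3) (Fin 3) ℂ) : Op N :=
  Matrix.of fun σ τ => ∏ k, A k (σ k) (τ k)

/-- The one-site operator `A` acting at the site `j`, and as the identity elsewhere. -/
def siteOp {N : ℕ} (j : Fin N) (A : Matrix (Fin 3) (Fin 3) ℂ) : Op N :=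
  tensorOp (Function.update (fun _ => 1) j A)

/-- The coupling constants `J_a`. -/
def coupJ (x : ℝ) : Fin 3 → ℝ := ![1, 1, (x ^ 2 - 2) / 2]

/-- The symmetric coupling constants `A_{ab}`, with `A_{aa} = J_a`. -/
def coupA (x : ℝ) : Matrix (Fin 3) (Fin 3) ℝ :=
  !![1, 1, x - 1;
     1, 1, x - 1;
     x - 1, x - 1, (x ^ 2 - 2) / 2]

/-- The operator `s_j^a` at the site `j`. -/
def spinAt {N : ℕ} (j : Fin N) (a : Fin 3) : Op N := siteOp j (spin a)

/-- The operator `s_{j+1}^a` at the right neighbour of the site `j`, with the twisted boundary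
condition `s_{N+1}^a = ε_a s_1^a`. -/
def spinNext {N : ℕ} (ε : Fin 3 → ℝ) (j : Fin N) (a : Fin 3) : Op N :=
  if h : (j : ℕ) + 1 < N then spinAt ⟨(j : ℕ) + 1, h⟩ a
  else ((ε a : ℝ) : ℂ) • spinAt ⟨0, j.pos⟩ a

/-- The spin-one XXZ Hamiltonian with the boundary condition `s_{N+1}^a = ε_a s_1^a`. -/
def hamiltonian (N : ℕ) (x : ℝ) (ε : Fin 3 → ℝ) : Op N :=
  ∑ j : Fin N,
    ((∑ a, (coupJ x a : ℂ) • (spinAt j a * spinNext ε j a + (2 : ℂ) • spinAt j a ^ 2)) -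
      ∑ a, ∑ b, (coupA x a b : ℂ) •
        (spinAt j a * spinAt j b * spinNext ε j a * spinNext ε j b))

/-- The signs of the diagonal twist. -/
def diagTwist : Fin 3 → ℝ := ![-1, -1, 1]

/-- The signs of the anti-diagonal twist. -/
def antidiagTwist : Fin 3 → ℝ := ![1, -1, -1]

/-- The spin-flip operator `F`. -/
def spinFlip (N : ℕ) : Op N := tensorOp fun _ => !![0, 0, 1; 0, 1, 0; 1, 0, 0]

/-- The total magnetisation `M = ∑_j s_j³`. -/
def magnetisation (N : ℕ) : Op N := ∑ j : Fin N, spinAt j 2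

/-- The magnetisation `1, 0, -1` of the states up, zero, down of one site. -/
def siteMag : Fin 3 → ℤ := ![1, 0, -1]

/-- The operator `(-1)^M`, which multiplies a canonical basis state by `-1` to the power of its
(integer) total magnetisation. -/
def parity (N : ℕ) : Op N :=
  Matrix.diagonal fun σ => (-1 : ℂ) ^ (∑ j, siteMag (σ j))

/-- The canonical basis diagonalises `M`, with the eigenvalues used in `parity`. -/
theorem magnetisation_eq_diagonal (N : ℕ) :
    magnetisation N = Matrix.diagonal fun σ => ((∑ j, siteMag (σ j) : ℤ) : ℂ) := by
  have hs : spin 2 = Matrix.diagonal fun s => (siteMag s : ℂ) := by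
    ext i k
    fin_cases i <;> fin_cases k <;> simp [spin, siteMag]
  have hj : ∀ j : Fin N, spinAt j 2 = Matrix.diagonal fun σ => (siteMag (σ j) : ℂ) := by
    intro j
    ext σ τ
    simp only [spinAt, siteOp, tensorOp, Matrix.of_apply, hs]
    by_cases h : σ = τ
    · subst h
      rw [Matrix.diagonal_apply_eq, Finset.prod_eq_single j]
      · simp
      · intro k _ hk
        simp [Function.update_of_ne hk]
      · simp
    · rw [Matrix.diagonal_apply_ne _ h]
      obtain ⟨k, hk⟩ := Function.ne_iff.mp h
      refine Finset.prod_eq_zero (Finset.mem_univ k) ?_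
      by_cases hkj : k = j
      · subst hkj
        simp [Matrix.diagonal_apply_ne _ hk]
      · simp [Function.update_of_ne hkj, Matrix.one_apply_ne hk]
  ext σ τ
  simp only [magnetisation, hj, Matrix.sum_apply]
  by_cases h : σ = τ
  · subst h
    simp
  · simp [Matrix.diagonal_apply_ne _ h]

/-- The subsector of the state space on which the operator `P` acts as the scalar `c`. -/
def sector {N : ℕ} (P : Op N) (c : ℂ) : Submodule ℂ ((Fin N → Fin 3) → ℂ) :=
  Module.End.eigenspace (Matrix.toLin' P) c

/-- `H` maps the subsectors `P ≡ 1` and `P ≡ -1` to themselves, and its restrictions to them have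
the same non-zero eigenvalues, with the same degeneracies. A number `E` is an eigenvalue if and
only if its degeneracy, the dimension of the eigenspace, is not `0`. -/
def SameNonzeroSpectrum {N : ℕ} (H P : Op N) : Prop :=
  ∃ (hp : ∀ v ∈ sector P 1, Matrix.toLin' H v ∈ sector P 1)
    (hm : ∀ v ∈ sector P (-1), Matrix.toLin' H v ∈ sector P (-1)),
    ∀ E : ℂ, E ≠ 0 →
      Module.finrank ℂ (Module.End.eigenspace ((Matrix.toLin' H).restrict hp) E) =
        Module.finrank ℂ (Module.End.eigenspace ((Matrix.toLin' H).restrict hm) E)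

end

end SpinOneXXZ

/-! The difference between the multiplicities of `E` on the two sectors of an involution `P` is the
trace of `P` against the spectral projection of `H` at `E`. For `E ≠ 0` that projection is a
polynomial in `H` without constant term, so it suffices that `P` commutes with the Hermitian matrix
`H` and that `tr (P H^(k+1)) = 0` for all `k` (`finrank_eigenspace_restrict_eq`).

The traces vanish by integrability. Take transfer matrices with a spin-1/2 auxiliary space whose
twist is a Pauli matrix, and expand them to first order in a nilpotent `e` at two points: `A = a₀ +
e a₁` from `laxCentre` and `B = b₀ + e b₁` from `laxShift`. The parity acts on the auxiliary space
as the other Pauli matrix, and the two anticommute; hence `P` anticommutes with `A` and `B`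
(`tensor_siteParity_mul_mpo`). By fusion, `A B` and `B A` both equal the spin-one transfer matrix
`T` minus the scalar `(-x + 2e)^N`. At this point `T = x^N S + e x^(N-1) D`, with `S` the twisted
shift and `2 S H = D + 2N S`. The scalars cancel in exactly the combination that gives `H`: `S H =
(x / (2 x^N)) (a₀ b₁ + a₁ b₀ + (2N/x) a₀ b₀)`, and likewise with the factors exchanged. Averaging
both forms writes `S H` through anticommutators that each contain `a₀` or `b₀`. These commute with
`S` and `H` by the Yang-Baxter equation and anticommute with `P`, so cyclicity of the trace kills
every moment (`trace_mul_pow_succ_eq_zero`).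

The argument divides by `x`; the case `x = 0` follows by continuity. Dual numbers over `ℂ` play the
role of the ring containing `e`. -/

namespace SpinOneXXZ

open scoped Kronecker

/-! ### Matrix product operators: products, intertwiners, splitting, first-order expansion. -/

section MatrixProductOperators

theorem prod_ofFn_update {M : Type*} [Monoid M] {N : ℕ} (f : Fin N → M) (j : Fin N) :
    ∃ p q : M, ∀ a, (List.ofFn (Function.update f j a)).prod = p * a * q := by
  induction N with
  | zero => exact j.elim0
  | succ N ih =>
    refine Fin.cases ?_ (fun j => ?_) j
    · refine ⟨1, (List.ofFn fun k : Fin N => f k.succ).prod, fun a => ?_⟩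
      simp [List.ofFn_succ]
    · obtain ⟨p, q, h⟩ := ih (fun k => f k.succ) j
      refine ⟨f 0 * p, q, fun a => ?_⟩
      have : (fun k : Fin N => Function.update f j.succ a k.succ) =
          Function.update (fun k => f k.succ) j a := by
        funext k
        by_cases hk : k = j
        · subst hk; simp
        · simp [hk]
      simp [List.ofFn_succ, this, h, mul_assoc, Function.update_of_ne (Fin.succ_ne_zero j).symm]

theorem prod_ofFn_update_update_succ {M : Type*} [Monoid M] {N : ℕ} (f : Fin (N + 1) → M)
    (j : Fin N) :
    ∃ p q : M, ∀ a b,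
      (List.ofFn (Function.update (Function.update f j.castSucc a) j.succ b)).prod =
        p * (a * b) * q := by
  induction N with
  | zero => exact j.elim0
  | succ N ih =>
    refine Fin.cases ?_ (fun j => ?_) j
    · refine ⟨1, (List.ofFn fun k : Fin N => f k.succ.succ).prod, fun a b => ?_⟩
      rw [List.ofFn_succ, List.ofFn_succ]
      simp [Function.update_of_ne (Fin.succ_succ_ne_one _), mul_assoc]
    · obtain ⟨p, q, h⟩ := ih (fun k => f k.succ) j
      refine ⟨f 0 * p, q, fun a b => ?_⟩
      have : (fun k : Fin (N + 1) => Function.update (Function.update f j.succ.castSucc a)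
          j.succ.succ b k.succ) =
          Function.update (Function.update (fun k => f k.succ) j.castSucc a) j.succ b := by
        funext k
        simp only [Function.update_apply, Fin.succ_inj, ← Fin.succ_castSucc]
      have h0 : (0 : Fin (N + 2)) ≠ j.succ.castSucc := by
        rw [← Fin.succ_castSucc]; exact (Fin.succ_ne_zero _).symm
      rw [List.ofFn_succ, this, List.prod_cons, h, Function.update_of_ne (Fin.succ_ne_zero _).symm,
        Function.update_of_ne h0]
      simp only [mul_assoc]

theorem prod_ofFn_update_last_update_zero {M : Type*} [Monoid M] {N : ℕ} (f : Fin (N + 2) → M) :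
    ∃ p : M, ∀ a b,
      (List.ofFn (Function.update (Function.update f (Fin.last _) a) 0 b)).prod = b * p * a := by
  refine ⟨(List.ofFn fun k : Fin N => f k.succ.castSucc).prod, fun a b => ?_⟩
  rw [List.ofFn_succ, List.ofFn_succ_last]
  simp [mul_assoc]

theorem sum_prod_ofFn {M ι : Type*} [Semiring M] [Fintype ι] {N : ℕ} (A : Fin N → ι → M) :
    ∑ ρ : Fin N → ι, (List.ofFn fun j => A j (ρ j)).prod =
      (List.ofFn fun j => ∑ q, A j q).prod := by
  induction N with
  | zero => simp
  | succ N ih =>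
    rw [← (Fin.consEquiv fun _ : Fin (N + 1) => ι).sum_comp, Fintype.sum_prod_type]
    simp only [List.ofFn_succ, List.prod_cons, Fin.consEquiv_apply, Fin.cons_zero, Fin.cons_succ]
    simp only [← Finset.mul_sum, ih (fun j => A j.succ), Finset.sum_mul]

theorem prod_ofFn_smul {R M : Type*} [CommSemiring R] [Semiring M] [Algebra R M] {N : ℕ}
    (c : Fin N → R) (f : Fin N → M) :
    (List.ofFn fun j => c j • f j).prod = (∏ j, c j) • (List.ofFn f).prod := by
  induction N with
  | zero => simp
  | succ N ih =>
    simp [List.ofFn_succ, ih (fun j => c j.succ), Fin.prod_univ_succ, smul_smul, mul_comm]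

/-- The Leibniz rule: a product containing two factors `e` vanishes. -/
theorem prod_ofFn_add_smul {R M : Type*} [CommRing R] [Ring M] [Algebra R M] {N : ℕ} {e : R}
    (he : e * e = 0) (f g : Fin N → M) :
    (List.ofFn fun j => f j + e • g j).prod =
      (List.ofFn f).prod + e • ∑ j, (List.ofFn (Function.update f j (g j))).prod := by
  induction N with
  | zero => simp
  | succ N ih =>
    have h : ∀ j : Fin N, (fun k : Fin N => Function.update f j.succ (g j.succ) k.succ) =
        Function.update (fun k => f k.succ) j (g j.succ) := by
      intro j
      funext k
      simp only [Function.update_apply, Fin.succ_inj]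
    simp only [List.ofFn_succ, List.prod_cons, ih (fun j => f j.succ) (fun j => g j.succ),
      Fin.sum_univ_succ, Function.update_self, h, Function.update_of_ne (Fin.succ_ne_zero _),
      Function.update_of_ne (Fin.succ_ne_zero _).symm, ← Finset.mul_sum]
    simp only [add_mul, mul_add, smul_mul_assoc, mul_smul_comm, smul_smul, he, zero_smul, smul_add]
    abel

variable {R : Type*} [CommRing R] {m n : Type*} [Fintype m] [DecidableEq m] [Fintype n]
  [DecidableEq n] {N : ℕ}

theorem kronecker_prod_ofFn (f : Fin N → Matrix m m R) (g : Fin N → Matrix n n R) :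
    (List.ofFn f).prod ⊗ₖ (List.ofFn g).prod = (List.ofFn fun j => f j ⊗ₖ g j).prod := by
  induction N with
  | zero => simp
  | succ N ih =>
    simp only [List.ofFn_succ, List.prod_cons, Matrix.mul_kronecker_mul,
      ih (fun j => f j.succ) (fun j => g j.succ)]

/-- The train argument: `G` is carried through the chain one site at a time. `G` may be rectangular,
so the same lemma serves for invariant subspaces and quotients. -/
theorem mul_prod_ofFn_of_intertwine (f : Fin N → Matrix m m R) (g : Fin N → Matrix n n R)
    (G : Matrix n m R) (h : ∀ j, G * f j = g j * G) :
    G * (List.ofFn f).prod = (List.ofFn g).prod * G := by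
  induction N with
  | zero => simp
  | succ N ih =>
    simp only [List.ofFn_succ, List.prod_cons]
    rw [← Matrix.mul_assoc, h, Matrix.mul_assoc, ih _ _ fun j => h j.succ, Matrix.mul_assoc]

theorem update_eval {α β : Type*} (W : Fin N → α → α → β) (j : Fin N) (U : α → α → β)
    (σ τ : Fin N → α) :
    (fun k => Function.update W j U k (σ k) (τ k)) =
      Function.update (fun k => W k (σ k) (τ k)) j (U (σ j) (τ j)) := by
  funext k
  by_cases hk : k = j
  · subst hk; simp
  · simp [hk]

/-- The matrix product operator on `N` sites with the local matrices `W j s t` and the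
twist `K`. -/
def mpo (K : Matrix n n R) (W : Fin N → Fin 3 → Fin 3 → Matrix n n R) :
    Matrix (Fin N → Fin 3) (Fin N → Fin 3) R :=
  Matrix.of fun σ τ => (K * (List.ofFn fun j => W j (σ j) (τ j)).prod).trace

theorem mpo_mul_mpo (K : Matrix m m R) (W : Fin N → Fin 3 → Fin 3 → Matrix m m R)
    (K' : Matrix n n R) (W' : Fin N → Fin 3 → Fin 3 → Matrix n n R) :
    mpo K W * mpo K' W' = mpo (K ⊗ₖ K') fun j s t => ∑ q, W j s q ⊗ₖ W' j q t := by
  ext σ τ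
  simp only [mpo, Matrix.mul_apply, Matrix.of_apply, ← Matrix.trace_kronecker,
    Matrix.mul_kronecker_mul, kronecker_prod_ofFn]
  rw [← Matrix.trace_sum, ← Finset.mul_sum,
    sum_prod_ofFn (fun j q => W j (σ j) q ⊗ₖ W' j q (τ j))]

/-- A change of basis in the auxiliary space is invisible to the trace, provided that it is
compatible with the twists. -/
theorem mpo_eq_of_intertwine {K : Matrix m m R} {W : Fin N → Fin 3 → Fin 3 → Matrix m m R}
    {K' : Matrix n n R} {W' : Fin N → Fin 3 → Fin 3 → Matrix n n R}
    (G : Matrix n m R) (G' : Matrix m n R) (hG : G' * G = 1) (hG' : G * G' = 1)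
    (hK : G * K = K' * G) (hW : ∀ j s t, G * W j s t = W' j s t * G) : mpo K W = mpo K' W' := by
  ext σ τ
  simp only [mpo, Matrix.of_apply]
  set P := (List.ofFn fun j => W j (σ j) (τ j)).prod
  set P' := (List.ofFn fun j => W' j (σ j) (τ j)).prod
  have h : G * P = P' * G := mul_prod_ofFn_of_intertwine _ _ G fun j => hW j _ _
  calc (K * P).trace = (G' * G * (K * P)).trace := by rw [hG, Matrix.one_mul]
    _ = (G' * (K' * P' * G)).trace := by
      rw [Matrix.mul_assoc, ← Matrix.mul_assoc G, hK, Matrix.mul_assoc K', h, Matrix.mul_assoc K']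
    _ = (K' * P').trace := by
      rw [Matrix.trace_mul_comm, Matrix.mul_assoc, hG', Matrix.mul_one]

/-- A matrix product operator whose auxiliary space has an invariant subspace of codimension one
splits into two. -/
theorem mpo_eq_add_of_invariant {K : Matrix m m R} {W : Fin N → Fin 3 → Fin 3 → Matrix m m R}
    {K' : Matrix n n R} {W' : Fin N → Fin 3 → Fin 3 → Matrix n n R} {k : Matrix Unit Unit R}
    {w : Fin N → Fin 3 → Fin 3 → Matrix Unit Unit R}
    (V : Matrix m n R) (U : Matrix n m R) (v : Matrix m Unit R) (u : Matrix Unit m R)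
    (hUV : U * V = 1) (hvu : u * v = 1) (h1 : V * U + v * u = 1)
    (hK : K * V = V * K') (hW : ∀ j s t, W j s t * V = V * W' j s t)
    (hk : u * K = k * u) (hw : ∀ j s t, u * W j s t = w j s t * u) :
    mpo K W = mpo K' W' + mpo k w := by
  ext σ τ
  simp only [mpo, Matrix.of_apply, Matrix.add_apply]
  set P := (List.ofFn fun j => W j (σ j) (τ j)).prod
  set P' := (List.ofFn fun j => W' j (σ j) (τ j)).prod
  set p := (List.ofFn fun j => w j (σ j) (τ j)).prod
  have hP : V * P' = P * V := mul_prod_ofFn_of_intertwine _ _ V fun j => (hW j _ _).symm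
  have hp : u * P = p * u := mul_prod_ofFn_of_intertwine _ _ u fun j => hw j _ _
  have e1 : (K * P * (V * U)).trace = (K' * P').trace := by
    rw [← Matrix.mul_assoc, Matrix.mul_assoc K, ← hP, ← Matrix.mul_assoc K, hK,
      Matrix.trace_mul_comm, Matrix.mul_assoc V, ← Matrix.mul_assoc U, hUV, Matrix.one_mul]
  have e2 : (K * P * (v * u)).trace = (k * p).trace := by
    rw [Matrix.trace_mul_comm, Matrix.mul_assoc, ← Matrix.mul_assoc u, hk, Matrix.mul_assoc k, hp,
      ← Matrix.mul_assoc k, Matrix.trace_mul_comm, Matrix.mul_assoc, hvu, Matrix.mul_one]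
  rw [← e1, ← e2, ← Matrix.trace_add, ← Matrix.mul_add, h1, Matrix.mul_one]

/-- A matrix product operator whose auxiliary space has an invariant line splits into two. -/
theorem mpo_eq_add_of_invariant' {K : Matrix m m R} {W : Fin N → Fin 3 → Fin 3 → Matrix m m R}
    {K' : Matrix n n R} {W' : Fin N → Fin 3 → Fin 3 → Matrix n n R} {k : Matrix Unit Unit R}
    {w : Fin N → Fin 3 → Fin 3 → Matrix Unit Unit R}
    (V : Matrix m n R) (U : Matrix n m R) (v : Matrix m Unit R) (u : Matrix Unit m R)
    (hUV : U * V = 1) (hvu : u * v = 1) (h1 : V * U + v * u = 1)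
    (hK : U * K = K' * U) (hW : ∀ j s t, U * W j s t = W' j s t * U)
    (hk : K * v = v * k) (hw : ∀ j s t, W j s t * v = v * w j s t) :
    mpo K W = mpo K' W' + mpo k w := by
  ext σ τ
  simp only [mpo, Matrix.of_apply, Matrix.add_apply]
  set P := (List.ofFn fun j => W j (σ j) (τ j)).prod
  set P' := (List.ofFn fun j => W' j (σ j) (τ j)).prod
  set p := (List.ofFn fun j => w j (σ j) (τ j)).prod
  have hP : U * P = P' * U := mul_prod_ofFn_of_intertwine _ _ U fun j => hW j _ _
  have hp : v * p = P * v := mul_prod_ofFn_of_intertwine _ _ v fun j => (hw j _ _).symm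
  have e1 : (K * P * (V * U)).trace = (K' * P').trace := by
    rw [Matrix.trace_mul_comm, Matrix.mul_assoc, ← Matrix.mul_assoc U, hK, Matrix.mul_assoc K',
      hP, ← Matrix.mul_assoc K', Matrix.trace_mul_comm, Matrix.mul_assoc, hUV, Matrix.mul_one]
  have e2 : (K * P * (v * u)).trace = (k * p).trace := by
    rw [← Matrix.mul_assoc, Matrix.mul_assoc K, ← hp, ← Matrix.mul_assoc K, hk,
      Matrix.trace_mul_comm, Matrix.mul_assoc v, ← Matrix.mul_assoc u, hvu, Matrix.one_mul]
  rw [← e1, ← e2, ← Matrix.trace_add, ← Matrix.mul_add, h1, Matrix.mul_one]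

theorem mpo_unit (k : R) (c : Fin N → R) :
    mpo (k • (1 : Matrix Unit Unit R)) (fun j s t => if s = t then c j • 1 else 0) =
      (k * ∏ j, c j) • 1 := by
  have h : ∀ σ τ : Fin N → Fin 3,
      (fun j => if σ j = τ j then c j • (1 : Matrix Unit Unit R) else 0) =
        fun j => (c j * if σ j = τ j then 1 else 0) • 1 := by
    intro σ τ
    funext j
    split_ifs <;> simp
  ext σ τ
  simp only [mpo, Matrix.of_apply, h, prod_ofFn_smul, Finset.prod_mul_distrib]
  by_cases hσ : σ = τ
  · subst hσ
    simp [List.ofFn_const, mul_comm]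
  · obtain ⟨i, hi⟩ := Function.ne_iff.mp hσ
    have : ∏ j, (if σ j = τ j then (1 : R) else 0) = 0 :=
      Finset.prod_eq_zero (Finset.mem_univ i) (if_neg hi)
    simp [this, hσ]

theorem mpo_smul (K : Matrix n n R) (c : R) (W : Fin N → Fin 3 → Fin 3 → Matrix n n R) :
    mpo K (fun j s t => c • W j s t) = c ^ N • mpo K W := by
  ext σ τ
  simp [mpo, prod_ofFn_smul]

theorem mpo_add_smul {e : R} (he : e * e = 0) (K : Matrix n n R)
    (W W' : Fin N → Fin 3 → Fin 3 → Matrix n n R) :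
    mpo K (fun j s t => W j s t + e • W' j s t) =
      mpo K W + e • ∑ j, mpo K (Function.update W j (W' j)) := by
  ext σ τ
  simp [mpo, prod_ofFn_add_smul he, Matrix.sum_apply, update_eval, Matrix.mul_add, Matrix.mul_sum,
    Matrix.trace_sum]

theorem mpo_map {S : Type*} [CommRing S] (f : R →+* S) (K : Matrix n n R)
    (W : Fin N → Fin 3 → Fin 3 → Matrix n n R) :
    (mpo K W).map f = mpo (K.map f) fun j s t => (W j s t).map f := by
  ext σ τ
  have h : (List.ofFn fun j => (W j (σ j) (τ j)).map f).prod =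
      (List.ofFn fun j => W j (σ j) (τ j)).prod.map f := by
    have := map_list_prod f.mapMatrix (List.ofFn fun j => W j (σ j) (τ j))
    simp only [List.map_ofFn] at this
    exact this.symm
  simp only [mpo, Matrix.map_apply, Matrix.of_apply, h, ← Matrix.map_mul]
  exact AddMonoidHom.map_trace f.toAddMonoidHom _

theorem tensor_mul_mpo (A : Fin N → Matrix (Fin 3) (Fin 3) R) (K : Matrix n n R)
    (W : Fin N → Fin 3 → Fin 3 → Matrix n n R) :
    (Matrix.of fun σ τ : Fin N → Fin 3 => ∏ k, A k (σ k) (τ k)) * mpo K W =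
      mpo K fun j s t => ∑ q, A j s q • W j q t := by
  ext σ τ
  simp only [mpo, Matrix.mul_apply, Matrix.of_apply, ← smul_eq_mul, ← Matrix.trace_smul]
  rw [← Matrix.trace_sum]
  simp only [smul_eq_mul, ← Matrix.mul_smul, ← prod_ofFn_smul]
  rw [← Finset.mul_sum, sum_prod_ofFn (fun j q => A j (σ j) q • W j q (τ j))]

theorem mpo_mul_tensor (A : Fin N → Matrix (Fin 3) (Fin 3) R) (K : Matrix n n R)
    (W : Fin N → Fin 3 → Fin 3 → Matrix n n R) :
    mpo K W * (Matrix.of fun σ τ : Fin N → Fin 3 => ∏ k, A k (σ k) (τ k)) =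
      mpo K fun j s t => ∑ q, A j q t • W j s q := by
  ext σ τ
  simp only [mpo, Matrix.mul_apply, Matrix.of_apply, mul_comm _ (∏ _, _)]
  simp only [← smul_eq_mul, ← Matrix.trace_smul]
  rw [← Matrix.trace_sum]
  simp only [smul_eq_mul, ← Matrix.mul_smul, ← prod_ofFn_smul]
  rw [← Finset.mul_sum, sum_prod_ofFn (fun j q => A j q (τ j) • W j (σ j) q)]

/-- The matrix product operator as a linear function of its local matrices at the site `j`. -/
def mpoAt (K : Matrix n n R) (W : Fin N → Fin 3 → Fin 3 → Matrix n n R) (j : Fin N) :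
    (Fin 3 → Fin 3 → Matrix n n R) →ₗ[R] Matrix (Fin N → Fin 3) (Fin N → Fin 3) R where
  toFun U := mpo K (Function.update W j U)
  map_add' U V := by
    ext σ τ
    obtain ⟨p, q, h⟩ := prod_ofFn_update (fun k => W k (σ k) (τ k)) j
    simp [mpo, h, update_eval, mul_add, add_mul, Matrix.trace_add]
  map_smul' c U := by
    ext σ τ
    obtain ⟨p, q, h⟩ := prod_ofFn_update (fun k => W k (σ k) (τ k)) j
    simp [mpo, h, update_eval]

end MatrixProductOperators

/-! ### L-operators, twists, fusion and inversion: identities at a single site. -/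

section LocalIdentities

variable {R : Type*} [CommRing R]

theorem forall_fin_three {p : Fin 3 → Prop} : (∀ i, p i) ↔ p 0 ∧ p 1 ∧ p 2 := by
  simp [Fin.forall_fin_succ]

/-- The L-operator with spin-1/2 auxiliary space at a site of spin one. -/
def lax (a b c r : R) : Fin 3 → Fin 3 → Matrix (Fin 2) (Fin 2) R
  | 0, 0 => !![a, 0; 0, c]
  | 0, 1 => !![0, 0; r, 0]
  | 0, 2 => 0
  | 1, 0 => !![0, r; 0, 0]
  | 1, 1 => !![b, 0; 0, b]
  | 1, 2 => !![0, 0; r, 0]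
  | 2, 0 => 0
  | 2, 1 => !![0, r; 0, 0]
  | 2, 2 => !![c, 0; 0, a]

/-- The L-operator of the exchange of two sites of spin one. -/
def exchangeLax (s t : Fin 3) : Matrix (Fin 3) (Fin 3) R :=
  Matrix.single t s 1

/-- The logarithmic derivative of the spin-one L-operator, up to the factor `x`. -/
def densityLax (x : R) : Fin 3 → Fin 3 → Matrix (Fin 3) (Fin 3) R
  | 0, 0 => !![2 * x ^ 2 - 2, 0, 0; 0, 2, 0; 0, 0, -2]
  | 0, 1 => !![0, 0, 0; x ^ 2, 0, 0; 0, 2 * x, 0]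
  | 0, 2 => 0
  | 1, 0 => !![0, x ^ 2, 0; 0, 0, 2 * x; 0, 0, 0]
  | 1, 1 => !![2, 0, 0; 0, 2, 0; 0, 0, 2]
  | 1, 2 => !![0, 0, 0; 2 * x, 0, 0; 0, x ^ 2, 0]
  | 2, 0 => 0
  | 2, 1 => !![0, 2 * x, 0; 0, 0, x ^ 2; 0, 0, 0]
  | 2, 2 => !![-2, 0, 0; 0, 2, 0; 0, 0, 2 * x ^ 2 - 2]

/-- The spin-one L-operator to first order at its shift point. -/
def fusedLax (x e : R) : Fin 3 → Fin 3 → Matrix (Fin 3) (Fin 3) R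
  | 0, 0 => !![x + e * (2 * x ^ 2 - 2), 0, 0; 0, e * 2, 0; 0, 0, -(e * 2)]
  | 0, 1 => !![0, 0, 0; x + e * x ^ 2, 0, 0; 0, e * (2 * x), 0]
  | 0, 2 => !![0, 0, 0; 0, 0, 0; x, 0, 0]
  | 1, 0 => !![0, x + e * x ^ 2, 0; 0, 0, e * (2 * x); 0, 0, 0]
  | 1, 1 => !![e * 2, 0, 0; 0, x + e * 2, 0; 0, 0, e * 2]
  | 1, 2 => !![0, 0, 0; e * (2 * x), 0, 0; 0, x + e * x ^ 2, 0]
  | 2, 0 => !![0, 0, x; 0, 0, 0; 0, 0, 0]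
  | 2, 1 => !![0, e * (2 * x), 0; 0, 0, x + e * x ^ 2; 0, 0, 0]
  | 2, 2 => !![-(e * 2), 0, 0; 0, e * 2, 0; 0, 0, x + e * (2 * x ^ 2 - 2)]

/-- The spin-1/2 L-operator to first order at its centre. -/
def laxCentre (x r e : R) : Fin 3 → Fin 3 → Matrix (Fin 2) (Fin 2) R :=
  lax (1 + e * x) (2 * e) (-1 + e * x) r

/-- The spin-1/2 L-operator to first order at its shifted centre. -/
def laxShift (x r e : R) : Fin 3 → Fin 3 → Matrix (Fin 2) (Fin 2) R :=
  lax (x + e * (x ^ 2 - 2)) (1 + e * x) (2 * e) r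

/-- The inclusion of the triplet into the tensor square of the doublet, the middle vector
being scaled by `g`. -/
def tripletIn (g : R) : Matrix (Fin 2 × Fin 2) (Fin 3) R
  | (0, 0) => ![1, 0, 0]
  | (0, 1) => ![0, g, 0]
  | (1, 0) => ![0, g, 0]
  | (1, 1) => ![0, 0, 1]

/-- The singlet in the tensor square of the doublet, scaled by `g`. -/
def singlet (g : R) : Matrix (Fin 2 × Fin 2) Unit R
  | (0, 0) => fun _ => 0
  | (0, 1) => fun _ => g
  | (1, 0) => fun _ => -g
  | (1, 1) => fun _ => 0

/-- The L-operator with spin-1/2 auxiliary space as a matrix that exchanges the order of its two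
spaces. -/
def laxSwap (L : Fin 3 → Fin 3 → Matrix (Fin 2) (Fin 2) R) :
    Matrix (Fin 3 × Fin 2) (Fin 2 × Fin 3) R :=
  Matrix.of fun p q => L p.1 q.2 p.2 q.1

/-- The L-operator with spin-1/2 auxiliary space as a matrix that exchanges the order of its two
spaces, in the opposite direction. -/
def laxSwap' (L : Fin 3 → Fin 3 → Matrix (Fin 2) (Fin 2) R) :
    Matrix (Fin 2 × Fin 3) (Fin 3 × Fin 2) R :=
  Matrix.of fun p q => L p.2 q.1 p.1 q.2

/-- The twist of the spin-1/2 auxiliary space for the anti-diagonal (`true`) and the diagonal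
(`false`) twist. -/
def twistHalf : Bool → Matrix (Fin 2) (Fin 2) R
  | true => !![0, 1; 1, 0]
  | false => !![1, 0; 0, -1]

/-- The twist of the spin-one auxiliary space for the anti-diagonal (`true`) and the diagonal
(`false`) twist. -/
def twistOne : Bool → Matrix (Fin 3) (Fin 3) R
  | true => !![0, 0, 1; 0, 1, 0; 1, 0, 0]
  | false => !![1, 0, 0; 0, -1, 0; 0, 0, 1]

theorem fusedLax_eq (x e : R) :
    ∀ s t, fusedLax x e s t = x • exchangeLax s t + e • densityLax x s t := by
  simp [← Matrix.ext_iff, forall_fin_three, fusedLax, exchangeLax, densityLax, Matrix.single_apply]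

theorem twistOne_mul_self (b : Bool) : (twistOne b * twistOne b : Matrix _ _ R) = 1 := by
  cases b <;> simp [twistOne, ← Matrix.ext_iff, forall_fin_three, Matrix.one_apply]

theorem twistHalf_mul_self (b : Bool) : (twistHalf b * twistHalf b : Matrix _ _ R) = 1 := by
  cases b <;> simp [twistHalf, ← Matrix.ext_iff, Fin.forall_fin_two, Matrix.one_apply]

/-- The anticommutation of two Pauli matrices, the only source of the sign in the relation between
the parity and the transfer matrices. -/
theorem twistHalf_mul_twistHalf_not (b : Bool) :
    (twistHalf (!b) * twistHalf b : Matrix _ _ R) = -(twistHalf b * twistHalf (!b)) := by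
  cases b <;> simp [twistHalf]

theorem kronecker_twistHalf_mul_tripletIn (b : Bool) (g : R) :
    (twistHalf b ⊗ₖ twistHalf b : Matrix _ _ R) * tripletIn g = tripletIn g * (twistOne b : Matrix _ _ R) := by
  ext ⟨i, i'⟩ k
  revert i i' k
  cases b <;> simp [Fin.forall_fin_two, forall_fin_three, twistHalf, twistOne, tripletIn,
    Matrix.mul_apply, Fintype.sum_prod_type, Fin.sum_univ_three]

theorem tripletIn_transpose_mul_kronecker_twistHalf (b : Bool) (g : R) :
    (tripletIn g).transpose * (twistHalf b ⊗ₖ twistHalf b : Matrix _ _ R) =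
      (twistOne b : Matrix _ _ R) * (tripletIn g).transpose := by
  ext k ⟨i, i'⟩
  revert i i' k
  cases b <;> simp [Fin.forall_fin_two, forall_fin_three, twistHalf, twistOne, tripletIn,
    Matrix.mul_apply, Fintype.sum_prod_type, Fin.sum_univ_three]

theorem kronecker_twistHalf_mul_singlet (b : Bool) (g : R) :
    (twistHalf b ⊗ₖ twistHalf b : Matrix _ _ R) * singlet g = singlet g * ((-1 : R) • (1 : Matrix Unit Unit R)) := by
  ext ⟨i, i'⟩ k
  revert i i' k
  cases b <;> simp [Fin.forall_fin_two, twistHalf, singlet,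
    Matrix.mul_apply, Fintype.sum_prod_type]

theorem singlet_transpose_mul_kronecker_twistHalf (b : Bool) (g : R) :
    (singlet g).transpose * (twistHalf b ⊗ₖ twistHalf b : Matrix _ _ R) =
      ((-1 : R) • (1 : Matrix Unit Unit R)) * (singlet g).transpose := by
  ext k ⟨i, i'⟩
  revert i i' k
  cases b <;> simp [Fin.forall_fin_two, twistHalf, singlet,
    Matrix.mul_apply, Fintype.sum_prod_type]

theorem tripletIn_transpose_mul_tripletIn {g h : R} (hgh : 2 * (g * h) = 1) :
    (tripletIn g).transpose * tripletIn h = 1 := by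
  ext k k'
  revert k k'
  simp [forall_fin_three, tripletIn, Matrix.mul_apply, Fintype.sum_prod_type, Matrix.one_apply]
  grind

theorem singlet_transpose_mul_singlet {g h : R} (hgh : 2 * (g * h) = 1) :
    (singlet g).transpose * singlet h = 1 := by
  ext k k'
  simp [singlet, Matrix.mul_apply, Fintype.sum_prod_type]
  grind

theorem triplet_add_singlet {g h g' h' c : R} (hgh : g * h = c) (hgh' : g' * h' = c)
    (hc : 2 * c = 1) :
    tripletIn h * (tripletIn g).transpose + singlet h' * (singlet g').transpose = 1 := by
  ext ⟨i, i'⟩ ⟨k, k'⟩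
  revert i i' k k'
  simp [Fin.forall_fin_two, tripletIn, singlet, Matrix.mul_apply, Fin.sum_univ_three,
    Matrix.one_apply]
  and_intros <;> grind

theorem laxSwap_mul_kronecker (b : Bool) (a₁ a₂ a₃ r : R) :
    laxSwap (lax a₁ a₂ a₃ r) * (twistHalf b ⊗ₖ twistOne b : Matrix _ _ R) =
      (twistOne b ⊗ₖ twistHalf b : Matrix _ _ R) * laxSwap (lax a₁ a₂ a₃ r) := by
  ext ⟨i, i'⟩ ⟨k, k'⟩
  revert i i' k k'
  cases b <;> simp [Fin.forall_fin_two, forall_fin_three, laxSwap, twistHalf, twistOne, lax,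
    Matrix.mul_apply, Fintype.sum_prod_type, Fin.sum_univ_three]

/-- The intertwiners of the Yang-Baxter equation are themselves L-operators. One at the centre is
inverted, up to a scalar, by one at the shifted centre, with the sign of `e` reversed; the scalar is
a unit when `x` is. -/
theorem laxSwap'_mul_laxSwap_laxCentre {x r e : R} (hr : r * r = x) (he : e * e = 0) :
    laxSwap' (laxShift x r e) * laxSwap (laxCentre x r (-e)) = (x - 2 * e) • 1 := by
  ext ⟨i, i'⟩ ⟨k, k'⟩
  revert i i' k k'
  simp [Fin.forall_fin_two, forall_fin_three, laxSwap, laxSwap', lax, laxCentre, laxShift,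
    Matrix.mul_apply, Fintype.sum_prod_type, Fin.sum_univ_three, Matrix.one_apply]
  and_intros <;> grind

theorem laxSwap_laxCentre_mul_laxSwap' {x r e : R} (hr : r * r = x) (he : e * e = 0) :
    laxSwap (laxCentre x r (-e)) * laxSwap' (laxShift x r e) = (x - 2 * e) • 1 := by
  ext ⟨i, i'⟩ ⟨k, k'⟩
  revert i i' k k'
  simp [Fin.forall_fin_two, forall_fin_three, laxSwap, laxSwap', lax, laxCentre, laxShift,
    Matrix.mul_apply, Fintype.sum_prod_type, Fin.sum_univ_three, Matrix.one_apply]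
  and_intros <;> grind

theorem laxSwap'_mul_laxSwap_laxShift {x r e : R} (hr : r * r = x) (he : e * e = 0) :
    laxSwap' (laxCentre x r e) * laxSwap (laxShift x r (-e)) = (x + 2 * e) • 1 := by
  ext ⟨i, i'⟩ ⟨k, k'⟩
  revert i i' k k'
  simp [Fin.forall_fin_two, forall_fin_three, laxSwap, laxSwap', lax, laxCentre, laxShift,
    Matrix.mul_apply, Fintype.sum_prod_type, Fin.sum_univ_three, Matrix.one_apply]
  and_intros <;> grind

theorem laxSwap_laxShift_mul_laxSwap' {x r e : R} (hr : r * r = x) (he : e * e = 0) :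
    laxSwap (laxShift x r (-e)) * laxSwap' (laxCentre x r e) = (x + 2 * e) • 1 := by
  ext ⟨i, i'⟩ ⟨k, k'⟩
  revert i i' k k'
  simp [Fin.forall_fin_two, forall_fin_three, laxSwap, laxSwap', lax, laxCentre, laxShift,
    Matrix.mul_apply, Fintype.sum_prod_type, Fin.sum_univ_three, Matrix.one_apply]
  and_intros <;> grind

/-- In the order centre, shift the singlet is a quotient of the auxiliary space, and in the opposite
order it is an invariant line. It carries the same scalar, the quantum determinant, both times. -/
theorem singlet_transpose_mul_fused {x r e g : R} (hr : r * r = x) (he : e * e = 0) :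
    ∀ s t, (singlet g).transpose * (∑ q, laxCentre x r e s q ⊗ₖ laxShift x r e q t) =
      (if s = t then (-x + 2 * e) • (1 : Matrix Unit Unit R) else 0) * (singlet g).transpose := by
  rw [forall_fin_three]
  simp only [forall_fin_three]
  and_intros <;>
  · ext k ⟨i, i'⟩
    revert i i' k
    simp [Fin.forall_fin_two, lax, laxCentre, laxShift, singlet,
      Matrix.mul_apply, Fintype.sum_prod_type, Fin.sum_univ_three]
    try (and_intros <;> grind)

theorem fused_mul_singlet {x r e g : R} (hr : r * r = x) (he : e * e = 0) :
    ∀ s t, (∑ q, laxShift x r e s q ⊗ₖ laxCentre x r e q t) * singlet g =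
      singlet g * (if s = t then (-x + 2 * e) • (1 : Matrix Unit Unit R) else 0) := by
  rw [forall_fin_three]
  simp only [forall_fin_three]
  and_intros <;>
  · ext ⟨i, i'⟩ k
    revert i i' k
    simp [Fin.forall_fin_two, lax, laxCentre, laxShift, singlet,
      Matrix.mul_apply, Fintype.sum_prod_type, Fin.sum_univ_three]
    try (and_intros <;> grind)

/-- The middle triplet vector is scaled by `1/r`, which makes the triplet block free of the square
root `r` of `x`. -/
theorem fused_mul_tripletIn {x r e ri : R} (hr : r * r = x) (hri : r * ri = 1) (he : e * e = 0) :
    ∀ s t, (∑ q, laxCentre x r e s q ⊗ₖ laxShift x r e q t) * tripletIn ri =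
      tripletIn ri * fusedLax x e s t := by
  rw [forall_fin_three]
  simp only [forall_fin_three]
  and_intros <;>
  · ext ⟨i, i'⟩ k
    revert i i' k
    simp [Fin.forall_fin_two, forall_fin_three, laxCentre, laxShift, lax, Fin.sum_univ_three,
      Matrix.mul_apply, Fintype.sum_prod_type, tripletIn, fusedLax]
    try (and_intros <;> grind)

theorem tripletIn_transpose_mul_fused {x r e ri : R} (hr : r * r = x) (hri : r * ri = 1)
    (he : e * e = 0) :
    ∀ s t, (tripletIn ri).transpose * (∑ q, laxShift x r e s q ⊗ₖ laxCentre x r e q t) =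
      fusedLax x e s t * (tripletIn ri).transpose := by
  rw [forall_fin_three]
  simp only [forall_fin_three]
  and_intros <;>
  · ext k ⟨i, i'⟩
    revert i i' k
    simp [Fin.forall_fin_two, forall_fin_three, laxCentre, laxShift, lax, Fin.sum_univ_three,
      Matrix.mul_apply, Fintype.sum_prod_type, tripletIn, fusedLax]
    try (and_intros <;> grind)

end LocalIdentities

/-! ### The Yang-Baxter equation to first order. -/

section Density

variable {R : Type*} [CommRing R]

set_option maxHeartbeats 4000000 in
-- The spin-1/2 operator is kept at `e = 0` and the spin-one operator at `e`. The intertwiner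
-- depends on the difference of the two parameters, hence `-e`.
theorem laxSwap_laxCentre_mul_fused {x r e : R} (hr : r * r = x) (he : e * e = 0) :
    ∀ s t, laxSwap (laxCentre x r (-e)) * (∑ q, laxCentre x r 0 s q ⊗ₖ fusedLax x e q t) =
      (∑ q, fusedLax x e s q ⊗ₖ laxCentre x r 0 q t) * laxSwap (laxCentre x r (-e)) := by
  rw [forall_fin_three]
  simp only [forall_fin_three]
  and_intros <;>
  · ext ⟨i, i'⟩ ⟨k, k'⟩
    revert i i' k k'
    simp [Fin.forall_fin_two, forall_fin_three, laxCentre, laxSwap, lax, Fin.sum_univ_three,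
      Matrix.mul_apply, Fintype.sum_prod_type, fusedLax]
    try (and_intros <;> grind)

set_option maxHeartbeats 4000000 in
theorem laxSwap_laxShift_mul_fused {x r e : R} (hr : r * r = x) (he : e * e = 0) :
    ∀ s t, laxSwap (laxShift x r (-e)) * (∑ q, laxShift x r 0 s q ⊗ₖ fusedLax x e q t) =
      (∑ q, fusedLax x e s q ⊗ₖ laxShift x r 0 q t) * laxSwap (laxShift x r (-e)) := by
  rw [forall_fin_three]
  simp only [forall_fin_three]
  and_intros <;>
  · ext ⟨i, i'⟩ ⟨k, k'⟩
    revert i i' k k'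
    simp [Fin.forall_fin_two, forall_fin_three, laxShift, laxSwap, lax, Fin.sum_univ_three,
      Matrix.mul_apply, Fintype.sum_prod_type, fusedLax]
    try (and_intros <;> grind)

end Density

/-! ### The local Hamiltonian density as an L-operator. -/

section

variable {R : Type*} [CommRing R]

/-- The local matrices of `A` and `B` at neighbouring sites, followed by the exchange of the
two sites. -/
def twoSiteLax (A B : Matrix (Fin 3) (Fin 3) R) (s t : Fin 3) : Matrix (Fin 3) (Fin 3) R :=
  Matrix.of fun a b => A a t * B s b

theorem exchangeLax_eq_twoSiteLax :
    (exchangeLax : Fin 3 → Fin 3 → Matrix (Fin 3) (Fin 3) R) = twoSiteLax 1 1 := by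
  ext s t a b
  simp only [exchangeLax, twoSiteLax, Matrix.single_apply, Matrix.of_apply, Matrix.one_apply,
    ← ite_and, mul_ite, mul_one, mul_zero]
  grind

theorem inv_sqrt_two_mul_self : ((1 / Real.sqrt 2 : ℝ) : ℂ) * ((1 / Real.sqrt 2 : ℝ) : ℂ) = 1 / 2 := by
  rw [← Complex.ofReal_mul, div_mul_div_comm, Real.mul_self_sqrt (by norm_num)]
  push_cast
  norm_num

/-- The products `s^a s^b` of the spin matrices. -/
noncomputable def spinMul : Fin 3 → Fin 3 → Matrix (Fin 3) (Fin 3) ℂ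
  | 0, 0 => !![1 / 2, 0, 1 / 2; 0, 1, 0; 1 / 2, 0, 1 / 2]
  | 0, 1 => !![Complex.I / 2, 0, -Complex.I / 2; 0, 0, 0; Complex.I / 2, 0, -Complex.I / 2]
  | 0, 2 => ((1 / Real.sqrt 2 : ℝ) : ℂ) • !![0, 0, 0; 1, 0, -1; 0, 0, 0]
  | 1, 0 => !![-Complex.I / 2, 0, -Complex.I / 2; 0, 0, 0; Complex.I / 2, 0, Complex.I / 2]
  | 1, 1 => !![1 / 2, 0, -1 / 2; 0, 1, 0; -1 / 2, 0, 1 / 2]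
  | 1, 2 => ((1 / Real.sqrt 2 : ℝ) : ℂ) • !![0, 0, 0; Complex.I, 0, Complex.I; 0, 0, 0]
  | 2, 0 => ((1 / Real.sqrt 2 : ℝ) : ℂ) • !![0, 1, 0; 0, 0, 0; 0, -1, 0]
  | 2, 1 => ((1 / Real.sqrt 2 : ℝ) : ℂ) • !![0, -Complex.I, 0; 0, 0, 0; 0, -Complex.I, 0]
  | 2, 2 => !![1, 0, 0; 0, 0, 0; 0, 0, 1]

theorem spin_zero : spin 0 = ((1 / Real.sqrt 2 : ℝ) : ℂ) • !![0, 1, 0; 1, 0, 1; 0, 1, 0] := rfl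
theorem spin_one : spin 1 = ((1 / Real.sqrt 2 : ℝ) : ℂ) •
      !![0, -Complex.I, 0; Complex.I, 0, -Complex.I; 0, Complex.I, 0] := rfl
theorem spin_two : spin 2 = !![1, 0, 0; 0, 0, 0; 0, 0, -1] := rfl

theorem spin_mul_spin : ∀ a b, spin a * spin b = spinMul a b := by
  have h := inv_sqrt_two_mul_self
  generalize hc : ((1 / Real.sqrt 2 : ℝ) : ℂ) = c at h
  have hI := Complex.I_mul_I
  simp only [forall_fin_three, spin_zero, spin_one, spin_two, spinMul, hc]
  and_intros <;>
  · ext i j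
    revert i j
    simp [forall_fin_three, Matrix.mul_apply, Fin.sum_univ_three]
    try (and_intros <;> grind)

theorem coupA_symm (x : ℝ) : ∀ a b, coupA x a b = coupA x b a := by
  simp [forall_fin_three, coupA]

/-- The local Hamiltonian, in symmetric form, is the logarithmic derivative of the spin-one
L-operator. -/
theorem density_eq (x : ℝ) :
    (2 : ℂ) • ((∑ a, (coupJ x a : ℂ) • (twoSiteLax (spin a) (spin a) + twoSiteLax (spin a ^ 2) 1 +
        twoSiteLax 1 (spin a ^ 2))) -
      ∑ a, ∑ b, (coupA x a b : ℂ) • twoSiteLax (spin a * spin b) (spin a * spin b)) =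
      densityLax (x : ℂ) + (2 : ℂ) • exchangeLax := by
  have h := inv_sqrt_two_mul_self
  simp only [pow_two, spin_mul_spin, Fin.sum_univ_three]
  rw [spin_zero, spin_one, spin_two]
  simp only [spinMul, coupJ, coupA]
  -- With `1/√2` replaced by an indeterminate subject to `c * c = 1/2`, every entry is a polynomial
  -- identity.
  generalize hc : ((1 / Real.sqrt 2 : ℝ) : ℂ) = c at h
  have hI := Complex.I_mul_I
  ext s t i j
  revert s t i j
  simp [forall_fin_three, twoSiteLax, densityLax, exchangeLax, Matrix.one_apply, Matrix.single_apply]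
  and_intros <;> grind

end

/-! ### The twisted shift and the Hamiltonian. -/

section Translation

open Function

theorem tensorOp_mul {N : ℕ} (A B : Fin N → Matrix (Fin 3) (Fin 3) ℂ) :
    tensorOp A * tensorOp B = tensorOp fun k => A k * B k := by
  ext σ τ
  simp only [tensorOp, Matrix.mul_apply, Matrix.of_apply, ← Finset.prod_mul_distrib]
  rw [Finset.prod_univ_sum, Fintype.piFinset_univ]

theorem tensorOp_one {N : ℕ} : tensorOp (fun _ : Fin N => 1) = 1 := by
  ext σ τ
  simp only [tensorOp, Matrix.of_apply, Matrix.one_apply, Finset.prod_ite_zero]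
  simp [funext_iff]

theorem siteOp_one {N : ℕ} (j : Fin N) : siteOp j 1 = 1 := by
  rw [siteOp, ← tensorOp_one]
  congr 1
  exact update_eq_self j _

theorem siteOp_mul_siteOp {N : ℕ} (j : Fin N) (A B : Matrix (Fin 3) (Fin 3) ℂ) :
    siteOp j A * siteOp j B = siteOp j (A * B) := by
  rw [siteOp, siteOp, tensorOp_mul, siteOp]
  congr 1
  funext k
  by_cases h : k = j
  · subst h; simp
  · simp [h]

theorem siteOp_mul_siteOp_of_ne {N : ℕ} {j k : Fin N} (hjk : j ≠ k)
    (A B : Matrix (Fin 3) (Fin 3) ℂ) :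
    siteOp j A * siteOp k B = tensorOp (update (update (fun _ => 1) j A) k B) := by
  rw [siteOp, siteOp, tensorOp_mul]
  congr 1
  funext l
  by_cases h : l = j
  · subst h; simp [hjk]
  · by_cases h' : l = k
    · subst h'; simp [h]
    · simp [h, h']

theorem siteOp_commute {N : ℕ} {j k : Fin N} (hjk : j ≠ k) (A B : Matrix (Fin 3) (Fin 3) ℂ) :
    siteOp j A * siteOp k B = siteOp k B * siteOp j A := by
  rw [siteOp_mul_siteOp_of_ne hjk, siteOp_mul_siteOp_of_ne hjk.symm, update_comm hjk]

theorem siteOp_smul {N : ℕ} (j : Fin N) (c : ℂ) (A : Matrix (Fin 3) (Fin 3) ℂ) :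
    siteOp j (c • A) = c • siteOp j A := by
  ext σ τ
  simp only [siteOp, tensorOp, Matrix.of_apply, Matrix.smul_apply, smul_eq_mul]
  rw [← Finset.mul_prod_erase _ _ (Finset.mem_univ j),
    ← Finset.mul_prod_erase _ _ (Finset.mem_univ j), update_self, update_self,
    Matrix.smul_apply, smul_eq_mul, mul_assoc]
  congr 2
  refine Finset.prod_congr rfl fun k hk => ?_
  rw [update_of_ne (Finset.ne_of_mem_erase hk), update_of_ne (Finset.ne_of_mem_erase hk)]

variable {n : ℕ}

/-- The operator `B` at the right neighbour of the site `j`, with the twist `K` at the boundary. -/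
noncomputable def nextOp (K : Matrix (Fin 3) (Fin 3) ℂ) (j : Fin (n + 2))
    (B : Matrix (Fin 3) (Fin 3) ℂ) : Op (n + 2) :=
  if h : (j : ℕ) + 1 < n + 2 then siteOp ⟨(j : ℕ) + 1, h⟩ B else siteOp 0 (K * B * K)

/-- The boundary signs are realised as conjugation by an involution, which is multiplicative;
products of spins can therefore be formed before the twist is applied. -/
theorem nextOp_mul_nextOp {K : Matrix (Fin 3) (Fin 3) ℂ} (hK : K * K = 1) (j : Fin (n + 2))
    (A B : Matrix (Fin 3) (Fin 3) ℂ) : nextOp K j A * nextOp K j B = nextOp K j (A * B) := by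
  unfold nextOp
  split_ifs
  · exact siteOp_mul_siteOp _ _ _
  · rw [siteOp_mul_siteOp]
    congr 1
    simp only [Matrix.mul_assoc]
    rw [← Matrix.mul_assoc K K, hK, Matrix.one_mul]

theorem nextOp_one {K : Matrix (Fin 3) (Fin 3) ℂ} (hK : K * K = 1) (j : Fin (n + 2)) :
    nextOp K j 1 = 1 := by
  unfold nextOp
  split_ifs
  · exact siteOp_one _
  · rw [Matrix.mul_one, hK, siteOp_one]

theorem sum_nextOp {K B : Matrix (Fin 3) (Fin 3) ℂ} (hB : K * B * K = B) :
    ∑ j : Fin (n + 2), nextOp K j B = ∑ j, siteOp j B := by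
  rw [← Equiv.sum_comp (Equiv.addRight (1 : Fin (n + 2))) fun j => siteOp j B]
  refine Finset.sum_congr rfl fun j _ => ?_
  unfold nextOp
  rw [hB]
  split_ifs with h
  · congr 1
    ext
    rw [Equiv.coe_addRight, Fin.val_add_one_of_lt' h]
  · congr 1
    have : j = Fin.last (n + 1) := by
      ext
      simp only [Fin.val_last]
      omega
    rw [this]
    exact (Fin.last_add_one _).symm

theorem spinNext_eq_nextOp {K : Matrix (Fin 3) (Fin 3) ℂ} {ε : Fin 3 → ℝ}
    (hε : ∀ a, K * spin a * K = ((ε a : ℝ) : ℂ) • spin a) (j : Fin (n + 2)) (a : Fin 3) :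
    spinNext ε j a = nextOp K j (spin a) := by
  unfold spinNext nextOp
  split_ifs
  · rfl
  · rw [hε, siteOp_smul]
    rfl

theorem twoSiteLax_mul {R : Type*} [CommRing R] (A B A' B' K : Matrix (Fin 3) (Fin 3) R)
    (s t s' t' : Fin 3) :
    twoSiteLax A B s t * K * twoSiteLax A' B' s' t' =
      Matrix.of fun a d => A a t * (B * K * A') s t' * B' s' d := by
  ext a d
  simp only [twoSiteLax, Matrix.mul_apply, Matrix.of_apply, Finset.sum_mul, Finset.mul_sum]
  exact Finset.sum_congr rfl fun i _ => Finset.sum_congr rfl fun j _ => by ring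

/-- The twisted shift operator. -/
noncomputable def twistedShift (n : ℕ) (K : Matrix (Fin 3) (Fin 3) ℂ) : Op (n + 2) :=
  mpo K fun _ => exchangeLax

theorem sum_smul_exchangeLax (A : Matrix (Fin 3) (Fin 3) ℂ) (s t : Fin 3) :
    ∑ q, A q t • (exchangeLax s q : Matrix (Fin 3) (Fin 3) ℂ) = twoSiteLax A 1 s t := by
  rw [exchangeLax_eq_twoSiteLax]
  ext a b
  simp [twoSiteLax, Matrix.sum_apply, Matrix.one_apply]

theorem twistedShift_mul_siteOp_mul_siteOp {K : Matrix (Fin 3) (Fin 3) ℂ} {j k : Fin (n + 2)}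
    (hjk : j ≠ k) (A B : Matrix (Fin 3) (Fin 3) ℂ) :
    twistedShift n K * (siteOp j A * siteOp k B) =
      mpo K (update (update (fun _ => exchangeLax) j (twoSiteLax A 1)) k (twoSiteLax B 1)) := by
  rw [siteOp_mul_siteOp_of_ne hjk, tensorOp, twistedShift, mpo_mul_tensor]
  congr 1
  funext l s t
  rw [sum_smul_exchangeLax]
  by_cases h' : l = k
  · subst h'; simp
  · by_cases h : l = j
    · subst h; simp [h']
    · simp [h, h', exchangeLax_eq_twoSiteLax]

/-- After multiplication by the shift, a nearest-neighbour operator changes only one local matrix of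
the matrix product. This makes the first-order term of the transfer matrix a sum of local densities.
-/
theorem twistedShift_mul_siteOp_mul_nextOp {K : Matrix (Fin 3) (Fin 3) ℂ} (hK : K * K = 1)
    (j : Fin (n + 2)) (A B : Matrix (Fin 3) (Fin 3) ℂ) :
    twistedShift n K * (siteOp j A * nextOp K j B) =
      mpoAt K (fun _ => exchangeLax) j (twoSiteLax A B) := by
  -- Rewriting the neighbouring matrix by its own value puts both sides in the form of a change at
  -- two sites.
  have hupd : ∀ k, j ≠ k → update (fun _ : Fin (n + 2) => exchangeLax) j (twoSiteLax A B) =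
      update (update (fun _ => exchangeLax) j (twoSiteLax A B)) k
        (exchangeLax : Fin 3 → Fin 3 → Matrix (Fin 3) (Fin 3) ℂ) := by
    intro k hk
    rw [update_comm hk, update_eq_self]
  unfold nextOp
  split_ifs with h
  · obtain ⟨i, rfl⟩ : ∃ i : Fin (n + 1), j = i.castSucc := ⟨⟨j, by omega⟩, rfl⟩
    have hk : (⟨(i.castSucc : ℕ) + 1, h⟩ : Fin (n + 2)) = i.succ := rfl
    have hne : i.castSucc ≠ i.succ := (Fin.castSucc_lt_succ).ne
    rw [hk, twistedShift_mul_siteOp_mul_siteOp hne]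
    change _ = mpo K _
    rw [hupd _ hne]
    ext σ τ
    obtain ⟨p, q, hpq⟩ := prod_ofFn_update_update_succ
      (fun k : Fin (n + 2) => (exchangeLax (σ k) (τ k) : Matrix (Fin 3) (Fin 3) ℂ)) i
    simp only [mpo, Matrix.of_apply, update_eval, hpq]
    simp only [exchangeLax_eq_twoSiteLax]
    have e := fun A B A' B' s t s' t' => twoSiteLax_mul (R := ℂ) A B A' B' 1 s t s' t'
    simp only [Matrix.mul_one] at e
    simp only [e, Matrix.mul_one, Matrix.one_mul]
  · obtain rfl : j = Fin.last (n + 1) := by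
      ext
      simp only [Fin.val_last]
      omega
    have hne : Fin.last (n + 1) ≠ 0 := Fin.last_pos.ne'
    rw [twistedShift_mul_siteOp_mul_siteOp hne]
    change _ = mpo K _
    rw [hupd _ hne]
    ext σ τ
    obtain ⟨p, hp⟩ := prod_ofFn_update_last_update_zero
      (fun k : Fin (n + 2) => (exchangeLax (σ k) (τ k) : Matrix (Fin 3) (Fin 3) ℂ))
    -- Cyclicity of the trace brings the last site next to the first, with the twist `K` between
    -- them.
    have ht : ∀ X Y : Matrix (Fin 3) (Fin 3) ℂ,
        (K * (Y * p * X)).trace = (X * K * Y * p).trace := by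
      intro X Y
      rw [← Matrix.mul_assoc, Matrix.trace_mul_comm]
      simp only [Matrix.mul_assoc]
    simp only [mpo, Matrix.of_apply, update_eval, hp, ht]
    simp only [exchangeLax_eq_twoSiteLax, twoSiteLax_mul, Matrix.mul_one, Matrix.one_mul]
    rw [← Matrix.mul_assoc K, ← Matrix.mul_assoc K, hK, Matrix.one_mul]

theorem mul_pow_two_mul_eq {K A : Matrix (Fin 3) (Fin 3) ℂ} (hK : K * K = 1) {c : ℂ}
    (hA : K * A * K = c • A) (hc : c * c = 1) : K * A ^ 2 * K = A ^ 2 := by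
  have : K * A ^ 2 * K = (K * A * K) * (K * A * K) := by
    simp only [pow_two, Matrix.mul_assoc]
    rw [← Matrix.mul_assoc K K, hK, Matrix.one_mul]
  rw [this, hA, Matrix.smul_mul, Matrix.mul_smul, smul_smul, hc, one_smul, pow_two]

/-- The one-site term `2 A²` is shared evenly between the two bonds at its site; at the boundary
this needs `A²` to be unaffected by the twist. -/
theorem sum_quadratic_eq {K A : Matrix (Fin 3) (Fin 3) ℂ} (hK : K * K = 1)
    (hA : K * A ^ 2 * K = A ^ 2) :
    ∑ j : Fin (n + 2), (siteOp j A * nextOp K j A + (2 : ℂ) • siteOp j A ^ 2) =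
      ∑ j : Fin (n + 2), (siteOp j A * nextOp K j A + siteOp j (A ^ 2) * nextOp K j 1 +
        siteOp j 1 * nextOp K j (A ^ 2)) := by
  have h : ∀ j : Fin (n + 2), siteOp j A ^ 2 = siteOp j (A ^ 2) := by
    intro j
    rw [pow_two, siteOp_mul_siteOp, pow_two]
  simp only [nextOp_one hK, siteOp_one, Matrix.one_mul, Matrix.mul_one, Finset.sum_add_distrib,
    sum_nextOp hA, h, two_smul, add_assoc]

theorem hamiltonian_eq {K : Matrix (Fin 3) (Fin 3) ℂ} (hK : K * K = 1)
    {ε : Fin 3 → ℝ} (hε : ∀ a, K * spin a * K = ((ε a : ℝ) : ℂ) • spin a)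
    (hε' : ∀ a, ε a * ε a = 1) (x : ℝ) :
    hamiltonian (n + 2) x ε = ∑ j : Fin (n + 2),
      ((∑ a, (coupJ x a : ℂ) • (siteOp j (spin a) * nextOp K j (spin a) +
        siteOp j (spin a ^ 2) * nextOp K j 1 + siteOp j 1 * nextOp K j (spin a ^ 2))) -
        ∑ a, ∑ b, (coupA x a b : ℂ) •
          (siteOp j (spin a * spin b) * nextOp K j (spin a * spin b))) := by
  have hsq : ∀ a, K * spin a ^ 2 * K = spin a ^ 2 := fun a =>
    mul_pow_two_mul_eq hK (hε a) (by rw [← Complex.ofReal_mul, hε', Complex.ofReal_one])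
  unfold hamiltonian
  rw [Finset.sum_sub_distrib, Finset.sum_sub_distrib]
  refine congrArg₂ (· - ·) ?_ ?_
  · rw [Finset.sum_comm]
    refine Eq.trans (Finset.sum_congr rfl fun a _ => ?_) Finset.sum_comm
    rw [← Finset.smul_sum, ← Finset.smul_sum, ← sum_quadratic_eq hK (hsq a)]
    simp only [spinNext_eq_nextOp hε, spinAt]
  · refine Finset.sum_congr rfl fun j _ => Finset.sum_congr rfl fun a _ =>
      Finset.sum_congr rfl fun b _ => ?_
    rw [spinNext_eq_nextOp hε, spinNext_eq_nextOp hε, spinAt, spinAt, siteOp_mul_siteOp,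
      Matrix.mul_assoc, nextOp_mul_nextOp hK]

theorem mpoAt_exchangeLax (K : Matrix (Fin 3) (Fin 3) ℂ) (j : Fin (n + 2)) :
    mpoAt K (fun _ => exchangeLax) j exchangeLax = twistedShift n K := by
  change mpo K _ = _
  rw [update_eq_self]
  rfl

theorem two_smul_twistedShift_mul_hamiltonian {K : Matrix (Fin 3) (Fin 3) ℂ} (hK : K * K = 1)
    {ε : Fin 3 → ℝ} (hε : ∀ a, K * spin a * K = ((ε a : ℝ) : ℂ) • spin a)
    (hε' : ∀ a, ε a * ε a = 1) (x : ℝ) :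
    (2 : ℂ) • (twistedShift n K * hamiltonian (n + 2) x ε) =
      (∑ j, mpoAt K (fun _ => exchangeLax) j (densityLax (x : ℂ))) +
        (2 * (n + 2 : ℂ)) • twistedShift n K := by
  have h : ∀ j : Fin (n + 2), (2 : ℂ) • (twistedShift n K *
      ((∑ a, (coupJ x a : ℂ) • (siteOp j (spin a) * nextOp K j (spin a) +
        siteOp j (spin a ^ 2) * nextOp K j 1 + siteOp j 1 * nextOp K j (spin a ^ 2))) -
        ∑ a, ∑ b, (coupA x a b : ℂ) •
          (siteOp j (spin a * spin b) * nextOp K j (spin a * spin b)))) =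
      mpoAt K (fun _ => exchangeLax) j (densityLax (x : ℂ)) + (2 : ℂ) • twistedShift n K := by
    intro j
    rw [← mpoAt_exchangeLax K j, ← map_smul, ← map_add, ← density_eq, map_smul]
    congr 1
    rw [mpoAt_exchangeLax K j, Matrix.mul_sub, map_sub, Finset.mul_sum, map_sum, Finset.mul_sum,
      map_sum]
    congr 1
    · refine Finset.sum_congr rfl fun a _ => ?_
      rw [Matrix.mul_smul, mul_add, mul_add, map_smul, map_add, map_add]
      simp only [twistedShift_mul_siteOp_mul_nextOp hK]
    · refine Finset.sum_congr rfl fun a _ => ?_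
      rw [Finset.mul_sum, map_sum]
      refine Finset.sum_congr rfl fun b _ => ?_
      rw [Matrix.mul_smul, map_smul, twistedShift_mul_siteOp_mul_nextOp hK]
  rw [hamiltonian_eq hK hε hε', Finset.mul_sum, Finset.smul_sum,
    Finset.sum_congr rfl fun j _ => h j, Finset.sum_add_distrib, Finset.sum_const,
    Finset.card_univ, Fintype.card_fin, ← Nat.cast_smul_eq_nsmul ℂ, smul_smul]
  congr 2
  push_cast
  ring

/-- The product of elementary matrices is elementary, so the operator is a cyclic relabelling of the
sites composed with `K` at the last site. -/
theorem isUnit_twistedShift {K : Matrix (Fin 3) (Fin 3) ℂ} (hK : K * K = 1) :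
    IsUnit (twistedShift n K) := by
  have hprod : ∀ (m : ℕ) (σ τ : Fin (m + 1) → Fin 3),
      (List.ofFn fun j => (exchangeLax (σ j) (τ j) : Matrix (Fin 3) (Fin 3) ℂ)).prod =
        Matrix.single (τ 0) (σ (Fin.last m))
          (∏ j : Fin m, (1 : Matrix (Fin 3) (Fin 3) ℂ) (σ j.castSucc) (τ j.succ)) := by
    intro m
    induction m with
    | zero => intro σ τ; simp [exchangeLax]
    | succ m ih =>
      intro σ τ
      rw [List.ofFn_succ, List.prod_cons, ih (fun j => σ j.succ) fun j => τ j.succ,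
        Fin.prod_univ_succ, exchangeLax]
      have h0 : (1 : Matrix (Fin 3) (Fin 3) ℂ) (σ (Fin.castSucc 0)) (τ (Fin.succ 0)) =
          if σ 0 = τ (Fin.succ 0) then 1 else 0 := rfl
      rw [h0, Fin.succ_last]
      by_cases h : σ 0 = τ (Fin.succ 0)
      · rw [h, Matrix.single_mul_single_same, if_pos rfl]
        rfl
      · rw [Matrix.single_mul_single_of_ne _ _ _ _ h, if_neg h, zero_mul, Matrix.single_zero]
  set G : Fin (n + 2) → Matrix (Fin 3) (Fin 3) ℂ := update (fun _ => 1) (Fin.last _) K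
  have hG : tensorOp G * tensorOp G = 1 := by
    rw [tensorOp_mul, ← tensorOp_one]
    congr 1
    funext k
    by_cases hk : k = Fin.last (n + 1)
    · subst hk; simp [G, hK]
    · simp [G, hk]
  let e : (Fin (n + 2) → Fin 3) ≃ (Fin (n + 2) → Fin 3) :=
    (Equiv.addRight (1 : Fin (n + 2))).symm.arrowCongr (Equiv.refl _)
  have hS : twistedShift n K = (tensorOp G).submatrix id e := by
    ext σ τ
    simp only [twistedShift, mpo, Matrix.of_apply, hprod, Matrix.submatrix_apply, id, tensorOp]
    rw [Matrix.trace_mul_single, Fin.prod_univ_castSucc (n := n + 1)]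
    have h1 : ∀ j : Fin (n + 1), e τ j.castSucc = τ j.succ := by
      intro j
      simp [e, Fin.coeSucc_eq_succ]
    have h2 : e τ (Fin.last _) = τ 0 := by
      simp [e]
    simp only [h1, h2, G, update_self, update_of_ne (Fin.castSucc_lt_last _).ne]
    rw [op_smul_eq_mul, mul_comm]
  refine IsUnit.of_mul_eq_one ((tensorOp G).submatrix e id) ?_
  rw [hS]
  have := Matrix.submatrix_mul_equiv (tensorOp G) (tensorOp G) id e id
  rw [this, hG, Matrix.submatrix_id_id]

end Translation

/-! ### Vanishing moments and equality of multiplicities. -/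

section LinearAlgebra

variable {ι : Type*} [Fintype ι]

/-- Moving `X` once around the trace passes `Z` freely and picks up a sign at `P`, so the two terms
of the anticommutator cancel. -/
theorem trace_mul_anticommutator_eq_zero {P Z X Y : Matrix ι ι ℂ} (hPX : P * X = -(X * P))
    (hXZ : X * Z = Z * X) : (P * Z * (X * Y + Y * X)).trace = 0 := by
  have h : (P * Z * (X * Y)).trace = -(P * Z * (Y * X)).trace := by
    calc (P * Z * (X * Y)).trace = (P * X * (Z * Y)).trace := by
          congr 1
          simp only [Matrix.mul_assoc]
          rw [← Matrix.mul_assoc Z, ← hXZ, Matrix.mul_assoc]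
      _ = -(X * (P * Z * Y)).trace := by
          rw [hPX, Matrix.neg_mul, Matrix.trace_neg]
          simp only [Matrix.mul_assoc]
      _ = -(P * Z * (Y * X)).trace := by
          rw [Matrix.trace_mul_comm, Matrix.mul_assoc (P * Z)]
  rw [Matrix.mul_add, Matrix.trace_add, h, neg_add_cancel]

variable [DecidableEq ι]

/-- One factor `H` is written as `S⁻¹ (S H)`, and the two factorisations are averaged. Every
resulting anticommutator contains `a₀` or `b₀`, so `a₁` and `b₁` need neither commute with `H` nor
anticommute with `P`. -/
theorem trace_mul_pow_succ_eq_zero {P S H a₀ a₁ b₀ b₁ : Matrix ι ι ℂ} {c y : ℂ} (hS : IsUnit S)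
    (hPa : P * a₀ = -(a₀ * P)) (hPb : P * b₀ = -(b₀ * P))
    (haS : a₀ * S = S * a₀) (hbS : b₀ * S = S * b₀) (haH : a₀ * H = H * a₀) (hbH : b₀ * H = H * b₀)
    (hab : S * H = c • (a₀ * b₁ + a₁ * b₀ + y • (a₀ * b₀)))
    (hba : S * H = c • (b₀ * a₁ + b₁ * a₀ + y • (b₀ * a₀))) (k : ℕ) :
    (P * H ^ (k + 1)).trace = 0 := by
  obtain ⟨S', hS'⟩ := hS.exists_left_inv
  have hS'' : S * S' = 1 := mul_eq_one_comm.mp hS'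
  have hcomm : ∀ a : Matrix ι ι ℂ, a * S = S * a → a * H = H * a →
      a * (H ^ k * S') = (H ^ k * S') * a := by
    intro a h1 h2
    have h3 : a * S' = S' * a := by
      calc a * S' = S' * S * a * S' := by rw [hS', Matrix.one_mul]
        _ = S' * (a * S) * S' := by rw [h1]; simp only [Matrix.mul_assoc]
        _ = S' * a := by simp only [Matrix.mul_assoc, hS'', Matrix.mul_one]
    have h4 : Commute a (H ^ k) := Commute.pow_right h2 k
    rw [← Matrix.mul_assoc, h4.eq, Matrix.mul_assoc, h3, Matrix.mul_assoc]
  have hsum : (2 : ℂ) • (P * H ^ (k + 1)) =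
      c • (P * (H ^ k * S') * (a₀ * b₁ + b₁ * a₀) + P * (H ^ k * S') * (b₀ * a₁ + a₁ * b₀) +
        y • (P * (H ^ k * S') * (a₀ * b₀ + b₀ * a₀))) := by
    have h1 : P * H ^ (k + 1) = P * (H ^ k * S') * (S * H) := by
      rw [pow_succ]
      simp only [Matrix.mul_assoc]
      rw [← Matrix.mul_assoc S', hS', Matrix.one_mul]
    rw [two_smul]
    nth_rw 1 [h1, hab]
    rw [h1, hba]
    simp only [mul_add, Matrix.mul_smul, smul_add]
    abel
  have h := congrArg Matrix.trace hsum
  rw [Matrix.trace_smul, Matrix.trace_smul, Matrix.trace_add, Matrix.trace_add, Matrix.trace_smul,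
    trace_mul_anticommutator_eq_zero hPa (hcomm a₀ haS haH),
    trace_mul_anticommutator_eq_zero hPb (hcomm b₀ hbS hbH),
    trace_mul_anticommutator_eq_zero hPa (hcomm a₀ haS haH)] at h
  simpa using h

theorem aeval_diagonal (d : ι → ℂ) (p : Polynomial ℂ) :
    Polynomial.aeval (Matrix.diagonal d) p = Matrix.diagonal fun i => p.eval (d i) := by
  have h := Polynomial.aeval_algHom_apply (Matrix.diagonalAlgHom (n := ι) (α := ℂ) ℂ) d p
  rw [Matrix.diagonalAlgHom_apply, Matrix.diagonalAlgHom_apply] at h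
  rw [h]
  congr 1
  funext i
  have h' := Polynomial.aeval_algHom_apply (Pi.evalAlgHom ℂ (fun _ : ι => ℂ) i) d p
  rw [Pi.evalAlgHom_apply, Pi.evalAlgHom_apply] at h'
  rw [← h', Polynomial.coe_aeval_eq_eval]

theorem aeval_eq_zero_of_isHermitian {H : Matrix ι ι ℂ} (hH : H.IsHermitian) {p : Polynomial ℂ}
    (hp : ∀ i, p.eval (hH.eigenvalues i : ℂ) = 0) : Polynomial.aeval H p = 0 := by
  rw [hH.spectral_theorem]
  have h := Polynomial.aeval_algHom_apply
    ((Unitary.conjStarAlgAut ℂ (Matrix ι ι ℂ) hH.eigenvectorUnitary :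
      Matrix ι ι ℂ ≃⋆ₐ[ℂ] Matrix ι ι ℂ).toAlgEquiv.toAlgHom)
    (Matrix.diagonal (RCLike.ofReal ∘ hH.eigenvalues)) p
  refine h.trans ?_
  rw [aeval_diagonal]
  have : (fun i => p.eval ((RCLike.ofReal ∘ hH.eigenvalues : ι → ℂ) i)) = 0 := funext hp
  rw [this]
  simp

/-- A polynomial without constant term that is `1` at `E` and vanishes on the rest of a finite
set. -/
theorem exists_polynomial_eval_eq_ite (s : Finset ℂ) {E : ℂ} (hE : E ≠ 0) :
    ∃ q : Polynomial ℂ, (Polynomial.X * q).eval E = 1 ∧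
      ∀ μ ∈ s, μ ≠ E → (Polynomial.X * q).eval μ = 0 := by
  refine ⟨Polynomial.C (E * ∏ μ ∈ s.erase E, (E - μ))⁻¹ *
    ∏ μ ∈ s.erase E, (Polynomial.X - Polynomial.C μ), ?_, fun μ hμ hμE => ?_⟩
  · have h : ∏ μ ∈ s.erase E, (E - μ) ≠ 0 :=
      Finset.prod_ne_zero_iff.mpr fun μ hμ => sub_ne_zero.mpr (Finset.ne_of_mem_erase hμ).symm
    simp only [Polynomial.eval_mul, Polynomial.eval_X, Polynomial.eval_C, Polynomial.eval_prod,
      Polynomial.eval_sub]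
    field_simp
  · have h : ∏ ν ∈ s.erase E, (μ - ν) = 0 :=
      Finset.prod_eq_zero (Finset.mem_erase.mpr ⟨hμE, hμ⟩) (sub_self _)
    simp only [Polynomial.eval_mul, Polynomial.eval_X, Polynomial.eval_C, Polynomial.eval_prod,
      Polynomial.eval_sub, h, mul_zero]

theorem finrank_eigenspace_restrict {H P Q : Matrix ι ι ℂ} (hP : P * P = 1)
    (hPH : P * H = H * P) {E : ℂ} (hQ : H * Q = E • Q)
    (hQ' : ∀ v, H.mulVec v = E • v → Q.mulVec v = v) {c : ℂ} (hc : c * c = 1)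
    (h : ∀ v ∈ Module.End.eigenspace (Matrix.toLin' P) c,
      Matrix.toLin' H v ∈ Module.End.eigenspace (Matrix.toLin' P) c) :
    (Module.finrank ℂ (Module.End.eigenspace ((Matrix.toLin' H).restrict h) E) : ℂ) =
      (Q.trace + c * (P * Q).trace) / 2 := by
  -- `Q` projects onto the eigenspace of `H`, and `(1 + c P) / 2` onto the sector of `P`. Their
  -- product projects onto the intersection, whose dimension is its trace.
  set R : Matrix ι ι ℂ := (1 / 2 : ℂ) • (Q + c • (P * Q)) with hR
  have hHR : H * R = E • R := by
    rw [hR, Matrix.mul_smul, mul_add, Matrix.mul_smul, hQ, ← Matrix.mul_assoc, ← hPH,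
      Matrix.mul_assoc, hQ]
    simp only [Matrix.mul_smul, smul_add, smul_smul]
    ring_nf
  have hPR : P * R = c • R := by
    rw [hR, Matrix.mul_smul, mul_add, Matrix.mul_smul, ← Matrix.mul_assoc, hP, Matrix.one_mul,
      smul_comm c, smul_add c, smul_smul c c, hc, one_smul, add_comm]
  have hproj : LinearMap.IsProj ((Module.End.eigenspace ((Matrix.toLin' H).restrict h) E).map
      (Submodule.subtype _)) (Matrix.toLin' R) := by
    refine ⟨fun v => ?_, fun v hv => ?_⟩
    · have hmem : Matrix.toLin' R v ∈ Module.End.eigenspace (Matrix.toLin' P) c := by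
        rw [Module.End.mem_eigenspace_iff]
        simp only [Matrix.toLin'_apply, Matrix.mulVec_mulVec, hPR, Matrix.smul_mulVec]
      refine ⟨⟨_, hmem⟩, ?_, rfl⟩
      rw [SetLike.mem_coe, Module.End.mem_eigenspace_iff]
      ext1
      simp only [LinearMap.coe_restrict_apply, Submodule.coe_smul, Matrix.toLin'_apply,
        Matrix.mulVec_mulVec, hHR, Matrix.smul_mulVec]
    · obtain ⟨⟨w, hw⟩, hwE, rfl⟩ := hv
      rw [SetLike.mem_coe, Module.End.mem_eigenspace_iff] at hwE
      have hwE' : H.mulVec w = E • w := congrArg Subtype.val hwE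
      rw [Module.End.mem_eigenspace_iff, Matrix.toLin'_apply] at hw
      simp only [Submodule.subtype_apply, Matrix.toLin'_apply, hR, Matrix.smul_mulVec,
        Matrix.add_mulVec, ← Matrix.mulVec_mulVec, hQ' w hwE', hw, smul_smul, hc, one_smul]
      rw [← two_smul ℂ w, smul_smul]
      norm_num
  have htr := hproj.trace
  rw [Submodule.finrank_map_subtype_eq, Matrix.trace_toLin'_eq] at htr
  rw [← htr, hR, Matrix.trace_smul, Matrix.trace_add, Matrix.trace_smul, smul_eq_mul, smul_eq_mul]
  ring

/-- If all the moments of the involution `P` with respect to a Hermitian matrix `H` commuting with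
it vanish, except possibly the zeroth, then a non-zero eigenvalue of `H` has the same multiplicity
on both eigenspaces of `P`. -/
theorem finrank_eigenspace_restrict_eq {H P : Matrix ι ι ℂ} (hH : H.IsHermitian)
    (hP : P * P = 1) (hPH : P * H = H * P) (htr : ∀ k : ℕ, (P * H ^ (k + 1)).trace = 0)
    (hp : ∀ v ∈ Module.End.eigenspace (Matrix.toLin' P) 1,
      Matrix.toLin' H v ∈ Module.End.eigenspace (Matrix.toLin' P) 1)
    (hm : ∀ v ∈ Module.End.eigenspace (Matrix.toLin' P) (-1),
      Matrix.toLin' H v ∈ Module.End.eigenspace (Matrix.toLin' P) (-1))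
    {E : ℂ} (hE : E ≠ 0) :
    Module.finrank ℂ (Module.End.eigenspace ((Matrix.toLin' H).restrict hp) E) =
      Module.finrank ℂ (Module.End.eigenspace ((Matrix.toLin' H).restrict hm) E) := by
  obtain ⟨q, hq, hq'⟩ := exists_polynomial_eval_eq_ite
    (Finset.univ.image fun i => (hH.eigenvalues i : ℂ)) hE
  set Q := Polynomial.aeval H (Polynomial.X * q) with hQdef
  have hQ : H * Q = E • Q := by
    have h0 : Polynomial.aeval H ((Polynomial.X - Polynomial.C E) * (Polynomial.X * q)) = 0 := by
      refine aeval_eq_zero_of_isHermitian hH fun i => ?_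
      rw [Polynomial.eval_mul]
      by_cases hi : (hH.eigenvalues i : ℂ) = E
      · rw [hi]; simp
      · rw [hq' _ (Finset.mem_image_of_mem _ (Finset.mem_univ i)) hi, mul_zero]
    rw [map_mul, map_sub, Polynomial.aeval_X, Polynomial.aeval_C, sub_mul, sub_eq_zero,
      Algebra.algebraMap_eq_smul_one, Matrix.smul_mul, Matrix.one_mul] at h0
    exact h0
  have hQ' : ∀ v, H.mulVec v = E • v → Q.mulVec v = v := by
    intro v hv
    have h := Module.End.aeval_apply_of_mem_apply_eq_smul (f := Matrix.toLinAlgEquiv' H)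
      (p := Polynomial.X * q) (show Matrix.toLinAlgEquiv' H v = E • v from hv)
    have h' := Polynomial.aeval_algHom_apply
      (Matrix.toLinAlgEquiv' : Matrix ι ι ℂ ≃ₐ[ℂ] _).toAlgHom H (Polynomial.X * q)
    rw [hq, one_smul] at h
    exact (congrArg (fun f => f v) h').symm.trans h
  -- The factor `X` in the polynomial leaves only positive powers of `H`; this is where `E ≠ 0`
  -- enters.
  have htrQ : (P * Q).trace = 0 := by
    rw [hQdef, map_mul, Polynomial.aeval_X, Polynomial.aeval_eq_sum_range, Finset.mul_sum,
      Finset.mul_sum, Matrix.trace_sum]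
    refine Finset.sum_eq_zero fun k _ => ?_
    rw [Matrix.mul_smul, Matrix.mul_smul, ← pow_succ', Matrix.trace_smul, htr, smul_zero]
  have h1 := finrank_eigenspace_restrict hP hPH hQ hQ' (one_mul (1 : ℂ)) hp
  have h2 := finrank_eigenspace_restrict hP hPH hQ hQ' (by norm_num) hm
  rw [htrQ, mul_zero] at h1 h2
  exact_mod_cast h1.trans h2.symm

end LinearAlgebra

/-! ### The parity operators anticommute with the spin-1/2 transfer matrices. -/

section Parity

variable {R : Type*} [CommRing R]

/-- The one-site factor of `(-1)^M` (`true`) and of the spin flip (`false`). -/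
def siteParity : Bool → Matrix (Fin 3) (Fin 3) R
  | true => !![-1, 0, 0; 0, 1, 0; 0, 0, -1]
  | false => !![0, 0, 1; 0, 1, 0; 1, 0, 0]

theorem siteParity_mul_self (b : Bool) : (siteParity b * siteParity b : Matrix _ _ R) = 1 := by
  cases b <;> simp [siteParity, ← Matrix.ext_iff, forall_fin_three, Matrix.one_apply]

theorem twistHalf_not_mul_sum_siteParity_smul_lax (b : Bool) (a₁ a₂ a₃ r : R) :
    ∀ s t, twistHalf (!b) * (∑ q, (siteParity b s q : R) • lax a₁ a₂ a₃ r q t) =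
      (∑ q, (siteParity b q t : R) • lax a₁ a₂ a₃ r s q) * twistHalf (!b) := by
  simp only [forall_fin_three, Fin.sum_univ_three]
  cases b <;> simp [siteParity, lax, twistHalf]

/-- Passing the parity through the chain conjugates the auxiliary space by the other Pauli matrix,
which changes the sign of the twist. -/
theorem tensor_siteParity_mul_mpo {N : ℕ} (b : Bool) (a₁ a₂ a₃ r : R) :
    (Matrix.of fun σ τ : Fin N → Fin 3 => ∏ k, siteParity b (σ k) (τ k)) *
        mpo (twistHalf b) (fun _ => lax a₁ a₂ a₃ r) =
      -(mpo (twistHalf b) (fun _ => lax a₁ a₂ a₃ r) *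
        (Matrix.of fun σ τ : Fin N → Fin 3 => ∏ k, siteParity b (σ k) (τ k))) := by
  have hneg : ∀ (K : Matrix (Fin 2) (Fin 2) R) (W : Fin N → Fin 3 → Fin 3 → Matrix _ _ R),
      -mpo K W = mpo (-K) W := by
    intro K W
    ext σ τ
    simp [mpo]
  rw [tensor_mul_mpo (fun _ => siteParity b), mpo_mul_tensor (fun _ => siteParity b), hneg]
  refine mpo_eq_of_intertwine (twistHalf (!b)) (twistHalf (!b)) (twistHalf_mul_self _)
    (twistHalf_mul_self _) ?_ fun j s t => twistHalf_not_mul_sum_siteParity_smul_lax b _ _ _ _ s t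
  rw [twistHalf_mul_twistHalf_not, Matrix.neg_mul]

end Parity

/-! ### Fusion and commutation of the transfer matrices. -/

section Fusion

variable {R : Type*} [CommRing R] {N : ℕ}

/-- The tensor square of the auxiliary doublet splits into a triplet and a singlet. The twist acts
on the singlet as `-1`, hence the minus sign before the scalar. -/
theorem mpo_laxCentre_mul_mpo_laxShift {x r e ri c : R} (hr : r * r = x) (hri : r * ri = 1)
    (he : e * e = 0) (hc : 2 * c = 1) (b : Bool) :
    mpo (twistHalf b) (fun _ : Fin N => laxCentre x r e) *
        mpo (twistHalf b) (fun _ => laxShift x r e) =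
      mpo (twistOne b) (fun _ => fusedLax x e) - (-x + 2 * e) ^ N • 1 := by
  rw [mpo_mul_mpo, mpo_eq_add_of_invariant (K' := twistOne b) (W' := fun _ => fusedLax x e)
    (tripletIn ri) (tripletIn (c * r)).transpose (singlet 1) (singlet c).transpose
    (tripletIn_transpose_mul_tripletIn (by grind)) (singlet_transpose_mul_singlet (by grind))
    (triplet_add_singlet (c := c) (by grind) (by grind) hc)
    (kronecker_twistHalf_mul_tripletIn b ri)
    (fun _ s t => fused_mul_tripletIn hr hri he s t)
    (singlet_transpose_mul_kronecker_twistHalf b c)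
    (fun _ s t => singlet_transpose_mul_fused hr he s t), mpo_unit]
  simp [sub_eq_add_neg]

theorem mpo_laxShift_mul_mpo_laxCentre {x r e ri c : R} (hr : r * r = x) (hri : r * ri = 1)
    (he : e * e = 0) (hc : 2 * c = 1) (b : Bool) :
    mpo (twistHalf b) (fun _ : Fin N => laxShift x r e) *
        mpo (twistHalf b) (fun _ => laxCentre x r e) =
      mpo (twistOne b) (fun _ => fusedLax x e) - (-x + 2 * e) ^ N • 1 := by
  rw [mpo_mul_mpo, mpo_eq_add_of_invariant' (K' := twistOne b) (W' := fun _ => fusedLax x e)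
    (tripletIn (c * r)) (tripletIn ri).transpose (singlet 1) (singlet c).transpose
    (tripletIn_transpose_mul_tripletIn (by grind)) (singlet_transpose_mul_singlet (by grind))
    (triplet_add_singlet (c := c) (by grind) (by grind) hc)
    (tripletIn_transpose_mul_kronecker_twistHalf b ri)
    (fun _ s t => tripletIn_transpose_mul_fused hr hri he s t)
    (kronecker_twistHalf_mul_singlet b 1)
    (fun _ s t => fused_mul_singlet hr he s t), mpo_unit]
  simp [sub_eq_add_neg]

theorem mpo_laxCentre_commute {x r e u : R} (hr : r * r = x) (he : e * e = 0)
    (hu : u * (x - 2 * e) = 1) (b : Bool) :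
    mpo (twistHalf b) (fun _ : Fin N => laxCentre x r 0) *
        mpo (twistOne b) (fun _ => fusedLax x e) =
      mpo (twistOne b) (fun _ => fusedLax x e) *
        mpo (twistHalf b) (fun _ => laxCentre x r 0) := by
  rw [mpo_mul_mpo, mpo_mul_mpo]
  refine mpo_eq_of_intertwine (laxSwap (laxCentre x r (-e))) (u • laxSwap' (laxShift x r e))
    ?_ ?_ (laxSwap_mul_kronecker b _ _ _ _) fun _ s t => laxSwap_laxCentre_mul_fused hr he s t
  · rw [Matrix.smul_mul, laxSwap'_mul_laxSwap_laxCentre hr he, smul_smul, hu, one_smul]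
  · rw [Matrix.mul_smul, laxSwap_laxCentre_mul_laxSwap' hr he, smul_smul, hu, one_smul]

theorem mpo_laxShift_commute {x r e u : R} (hr : r * r = x) (he : e * e = 0)
    (hu : u * (x + 2 * e) = 1) (b : Bool) :
    mpo (twistHalf b) (fun _ : Fin N => laxShift x r 0) *
        mpo (twistOne b) (fun _ => fusedLax x e) =
      mpo (twistOne b) (fun _ => fusedLax x e) *
        mpo (twistHalf b) (fun _ => laxShift x r 0) := by
  rw [mpo_mul_mpo, mpo_mul_mpo]
  refine mpo_eq_of_intertwine (laxSwap (laxShift x r (-e))) (u • laxSwap' (laxCentre x r e))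
    ?_ ?_ (laxSwap_mul_kronecker b _ _ _ _) fun _ s t => laxSwap_laxShift_mul_fused hr he s t
  · rw [Matrix.smul_mul, laxSwap'_mul_laxSwap_laxShift hr he, smul_smul, hu, one_smul]
  · rw [Matrix.mul_smul, laxSwap_laxShift_mul_laxSwap' hr he, smul_smul, hu, one_smul]

end Fusion

/-! ### Expansion of the spin-one transfer matrix over the dual numbers. -/

section DualNumbers

open TrivSqZeroExt
open scoped DualNumber

variable {ι : Type*}

theorem map_fst_mul [Fintype ι] (A B : Matrix ι ι ℂ[ε]) : (A * B).map fst = A.map fst * B.map fst := by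
  ext i j
  simp [Matrix.mul_apply, fst_sum]

theorem map_snd_mul [Fintype ι] (A B : Matrix ι ι ℂ[ε]) :
    (A * B).map snd = A.map fst * B.map snd + A.map snd * B.map fst := by
  ext i j
  simp [Matrix.mul_apply, snd_sum, Finset.sum_add_distrib]

theorem map_fst_map_inl (A : Matrix ι ι ℂ) : (A.map (inl : ℂ → ℂ[ε])).map fst = A := by
  ext i j
  simp

theorem map_snd_map_inl (A : Matrix ι ι ℂ) : (A.map (inl : ℂ → ℂ[ε])).map snd = 0 := by
  ext i j
  simp

variable {n : ℕ}

/-- The sum of the local densities, multiplied by the twisted shift. -/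
noncomputable def shiftedDensity (n : ℕ) (K : Matrix (Fin 3) (Fin 3) ℂ) (x : ℂ) : Op (n + 2) :=
  ∑ j, mpoAt K (fun _ => exchangeLax) j (densityLax x)

theorem mpo_fusedLax_eq {x : ℂ} (hx : x ≠ 0) (b : Bool) :
    mpo (twistOne b) (fun _ : Fin (n + 2) => fusedLax (inl x : ℂ[ε]) ε) =
      (x ^ (n + 2) • twistedShift n (twistOne b)).map inl +
        (ε : ℂ[ε]) • ((x ^ (n + 2) * x⁻¹) • shiftedDensity n (twistOne b) x).map inl := by
  have hK : (twistOne b : Matrix _ _ ℂ).map (inlHom ℂ ℂ) = twistOne b := by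
    cases b <;> simp [← Matrix.ext_iff, forall_fin_three, twistOne]
  have hE : ∀ s t, (exchangeLax s t : Matrix _ _ ℂ).map (inlHom ℂ ℂ) = exchangeLax s t := by
    intro s t
    ext1 i j
    simp only [exchangeLax, Matrix.map_apply, Matrix.single_apply]
    split_ifs <;> simp
  have hD : ∀ s t, (densityLax x s t).map (inlHom ℂ ℂ) = densityLax (inl x : ℂ[ε]) s t := by
    have h2 : (inl 2 : ℂ[ε]) = 2 := map_ofNat (inlHom ℂ ℂ) 2
    have hx : inl x = (inlHom ℂ ℂ) x := rfl
    rw [hx]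
    simp [← Matrix.ext_iff, forall_fin_three, densityLax, h2]
  -- Extracting `x` from each site leaves the exchange operator plus the nilpotent `ε / x` times the
  -- density, to which the Leibniz rule applies.
  have hL : (fun _ : Fin (n + 2) => fusedLax (inl x : ℂ[ε]) ε) = fun _ s t =>
      (inl x : ℂ[ε]) • (exchangeLax s t + (ε * inl x⁻¹ : ℂ[ε]) • densityLax (inl x) s t) := by
    funext j s t
    rw [fusedLax_eq, smul_add, smul_smul]
    congr 2
    rw [mul_left_comm, ← inl_mul, mul_inv_cancel₀ hx, inl_one, mul_one]
  have he : (ε * inl x⁻¹ : ℂ[ε]) * (ε * inl x⁻¹) = 0 := by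
    rw [mul_mul_mul_comm, DualNumber.eps_mul_eps, zero_mul]
  have h0 : mpo (twistOne b) (fun _ : Fin (n + 2) => exchangeLax) =
      (twistedShift n (twistOne b)).map (inlHom ℂ ℂ) := by
    rw [twistedShift, mpo_map, hK]
    simp only [hE]
  have h1 : ∑ j, mpo (twistOne b) (Function.update (fun _ : Fin (n + 2) => exchangeLax) j
        (densityLax (inl x : ℂ[ε]))) =
      (shiftedDensity n (twistOne b) x).map (inlHom ℂ ℂ) := by
    have : (shiftedDensity n (twistOne b) x).map (inlHom ℂ ℂ) =
        (inlHom ℂ ℂ).mapMatrix (shiftedDensity n (twistOne b) x) := rfl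
    rw [this, shiftedDensity, map_sum]
    refine Finset.sum_congr rfl fun j _ => ?_
    change _ = (mpo _ _).map _
    rw [mpo_map, hK]
    congr 1
    funext k s t
    by_cases hk : k = j
    · subst hk
      rw [Function.update_self, Function.update_self, hD]
    · rw [Function.update_of_ne hk, Function.update_of_ne hk, hE]
  rw [hL, mpo_smul]
  have h := mpo_add_smul he (twistOne b) (fun _ : Fin (n + 2) => exchangeLax)
    (fun _ => densityLax (inl x : ℂ[ε]))
  rw [h, h0, h1]
  ext i j
  · simp
  · simp
    ring

end DualNumbers

/-! ### Factorisation of the Hamiltonian and its moments for `x ≠ 0`. -/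

section Moments

open TrivSqZeroExt
open scoped DualNumber

theorem lax_map {R S : Type*} [CommRing R] [CommRing S] (f : R →+* S) (a₁ a₂ a₃ r : R) :
    ∀ s t, (lax a₁ a₂ a₃ r s t).map f = lax (f a₁) (f a₂) (f a₃) (f r) s t := by
  simp [← Matrix.ext_iff, forall_fin_three, Fin.forall_fin_two, lax]

theorem mpo_lax_map {R S : Type*} [CommRing R] [CommRing S] (f : R →+* S) (N : ℕ) (b : Bool)
    (a₁ a₂ a₃ r : R) :
    (mpo (twistHalf b) fun _ : Fin N => lax a₁ a₂ a₃ r).map f =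
      mpo (twistHalf b) fun _ => lax (f a₁) (f a₂) (f a₃) (f r) := by
  have hK : (twistHalf b : Matrix _ _ R).map f = twistHalf b := by
    cases b <;> simp [← Matrix.ext_iff, Fin.forall_fin_two, twistHalf]
  rw [mpo_map, hK]
  simp only [lax_map]

/-- Identifies the zeroth-order part of a transfer matrix with the transfer matrix at `ε = 0`, for
which commutation is known. -/
theorem map_fst_mpo_lax_map_inl (N : ℕ) (b : Bool) (a₁ a₂ a₃ r : ℂ[ε]) :
    ((mpo (twistHalf b) fun _ : Fin N => lax a₁ a₂ a₃ r).map fst).map (inl : ℂ → ℂ[ε]) =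
      mpo (twistHalf b) fun _ => lax (inl a₁.fst : ℂ[ε]) (inl a₂.fst) (inl a₃.fst) (inl r.fst) := by
  have h1 := mpo_lax_map (fstHom ℂ ℂ ℂ : ℂ[ε] →ₐ[ℂ] ℂ).toRingHom N b a₁ a₂ a₃ r
  have h2 := mpo_lax_map (inlHom ℂ ℂ) N b a₁.fst a₂.fst a₃.fst r.fst
  exact (congrArg (fun M => M.map (inl : ℂ → ℂ[ε])) h1).trans h2

theorem tensorOp_siteParity_mul_map (N : ℕ) (b : Bool) (a₁ a₂ a₃ r : ℂ[ε]) :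
    let P : Op N := tensorOp fun _ => siteParity b
    let t := mpo (twistHalf b) fun _ : Fin N => lax a₁ a₂ a₃ r
    P * t.map fst = -(t.map fst * P) ∧ P * t.map snd = -(t.map snd * P) := by
  intro P t
  have hP : (Matrix.of fun σ τ : Fin N → Fin 3 => ∏ k, (siteParity b (σ k) (τ k) : ℂ[ε])) =
      P.map (inl : ℂ → ℂ[ε]) := by
    have h : ∀ i j, (siteParity b i j : ℂ[ε]) = inlHom ℂ ℂ (siteParity b i j) := by
      cases b <;> simp [siteParity, forall_fin_three]
    ext1 σ τ
    simp only [Matrix.of_apply, h, ← map_prod]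
    rfl
  have h : P.map (inl : ℂ → ℂ[ε]) * t = -(t * P.map (inl : ℂ → ℂ[ε])) := by
    rw [← hP]
    exact tensor_siteParity_mul_mpo b a₁ a₂ a₃ r
  have h1 := congrArg (fun M => M.map fst) h
  have h2 := congrArg (fun M => M.map snd) h
  have hn1 : ∀ M : Matrix (Fin N → Fin 3) (Fin N → Fin 3) ℂ[ε],
    (-M).map fst = -M.map fst := fun M => by ext i j; simp
  have hn2 : ∀ M : Matrix (Fin N → Fin 3) (Fin N → Fin 3) ℂ[ε],
    (-M).map snd = -M.map snd := fun M => by ext i j; simp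
  simp only [hn1, hn2, map_fst_mul, map_snd_mul, map_fst_map_inl, map_snd_map_inl, zero_mul,
    mul_zero, add_zero, zero_add] at h1 h2
  exact ⟨h1, h2⟩

variable {n : ℕ}

theorem commute_of_map_inl_mul {ι : Type*} [Fintype ι] {a T₀ T₁ : Matrix ι ι ℂ}
    (h : a.map (inl : ℂ → ℂ[ε]) * (T₀.map (inl : ℂ → ℂ[ε]) + (ε : ℂ[ε]) • T₁.map (inl : ℂ → ℂ[ε]) : Matrix ι ι ℂ[ε]) =
      (T₀.map (inl : ℂ → ℂ[ε]) + (ε : ℂ[ε]) • T₁.map (inl : ℂ → ℂ[ε]) : Matrix ι ι ℂ[ε]) * a.map (inl : ℂ → ℂ[ε])) :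
    a * T₀ = T₀ * a ∧ a * T₁ = T₁ * a := by
  have e1 : (T₀.map (inl : ℂ → ℂ[ε]) + (ε : ℂ[ε]) • T₁.map (inl : ℂ → ℂ[ε]) : Matrix ι ι ℂ[ε]).map fst = T₀ := by
    ext i j
    simp
  have e2 : (T₀.map (inl : ℂ → ℂ[ε]) + (ε : ℂ[ε]) • T₁.map (inl : ℂ → ℂ[ε]) : Matrix ι ι ℂ[ε]).map snd = T₁ := by
    ext i j
    simp
  have h1 := congrArg (fun M => M.map fst) h
  have h2 := congrArg (fun M => M.map snd) h
  simp only [map_fst_mul, map_snd_mul, map_fst_map_inl, map_snd_map_inl, zero_mul,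
    mul_zero, add_zero, zero_add, e1, e2] at h1 h2
  exact ⟨h1, h2⟩

theorem map_mul_eq {N : ℕ} {x : ℂ} {ι : Type*} [Fintype ι] [DecidableEq ι]
    {A B : Matrix ι ι ℂ[ε]} {T₀ T₁ : Matrix ι ι ℂ}
    (h : A * B = T₀.map (inl : ℂ → ℂ[ε]) + (ε : ℂ[ε]) • T₁.map (inl : ℂ → ℂ[ε]) -
      (-inl x + 2 * ε : ℂ[ε]) ^ (N + 1) • (1 : Matrix ι ι ℂ[ε])) :
    A.map fst * B.map fst = T₀ - (-x) ^ (N + 1) • (1 : Matrix ι ι ℂ) ∧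
      A.map fst * B.map snd + A.map snd * B.map fst =
        T₁ - (2 * (N + 1) * (-x) ^ N) • (1 : Matrix ι ι ℂ) := by
  have hf : (-inl x + 2 * ε : ℂ[ε]).fst = -x := by simp
  have hs : (-inl x + 2 * ε : ℂ[ε]).snd = 2 := by
    have : (2 : ℂ[ε]).fst = 2 := rfl
    simp [this]
  rw [← map_fst_mul, ← map_snd_mul, h]
  refine ⟨?_, ?_⟩
  · ext i j
    by_cases hij : i = j
    · subst hij
      simp [hf]
    · simp [hij]
  · ext i j
    by_cases hij : i = j
    · subst hij
      simp [hf, hs, snd_pow]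
      ring
    · simp [hij]

/-- The twisted Hamiltonian at `x ≠ 0` commutes with the parity operator, which has trace zero
against its positive powers. -/
theorem tensorOp_siteParity_mul_hamiltonian_of_ne_zero (b : Bool) {ε' : Fin 3 → ℝ}
    (hε : ∀ a, twistOne b * spin a * twistOne b = ((ε' a : ℝ) : ℂ) • spin a)
    (hε' : ∀ a, ε' a * ε' a = 1) {x : ℝ} (hx : x ≠ 0) :
    let P : Op (n + 2) := tensorOp fun _ => siteParity b
    let H := hamiltonian (n + 2) x ε'
    P * H = H * P ∧ ∀ k : ℕ, (P * H ^ (k + 1)).trace = 0 := by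
  intro P H
  set y : ℂ := (x : ℂ) with hy
  have hy0 : y ≠ 0 := by simpa [hy] using hx
  -- The root is taken in `ℂ` because `x` may be negative.
  obtain ⟨r, hr⟩ := IsAlgClosed.exists_eq_mul_self y
  have hr0 : r ≠ 0 := by
    rintro rfl
    exact hy0 (by simpa using hr)
  have hrr : (inl r : ℂ[ε]) * inl r = inl y := by rw [← inl_mul, ← hr]
  have hri : (inl r : ℂ[ε]) * inl r⁻¹ = 1 := by rw [← inl_mul, mul_inv_cancel₀ hr0, inl_one]
  have hhalf : (2 : ℂ[ε]) * inl (1 / 2) = 1 := by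
    have : (2 : ℂ[ε]) = inl 2 := rfl
    rw [this, ← inl_mul]
    norm_num
  have hee : (ε : ℂ[ε]) * ε = 0 := DualNumber.eps_mul_eps
  set A := mpo (twistHalf b) (fun _ : Fin (n + 2) => laxCentre (inl y : ℂ[ε]) (inl r) ε)
  set B := mpo (twistHalf b) (fun _ : Fin (n + 2) => laxShift (inl y : ℂ[ε]) (inl r) ε)
  set S := twistedShift n (twistOne b)
  set D := shiftedDensity n (twistOne b) y
  have hT := mpo_fusedLax_eq (n := n) hy0 b
  have hAB := mpo_laxCentre_mul_mpo_laxShift (N := n + 2) hrr hri hee hhalf b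
  have hBA := mpo_laxShift_mul_mpo_laxCentre (N := n + 2) hrr hri hee hhalf b
  rw [hT] at hAB hBA
  obtain ⟨hab0, hab1⟩ := map_mul_eq (N := n + 1) hAB
  obtain ⟨hba0, hba1⟩ := map_mul_eq (N := n + 1) hBA
  have hu1 : IsUnit (inl y - 2 * ε : ℂ[ε]) := by
    rw [isUnit_iff_isUnit_fst]
    simpa using hy0
  have hu2 : IsUnit (inl y + 2 * ε : ℂ[ε]) := by
    rw [isUnit_iff_isUnit_fst]
    simpa using hy0
  obtain ⟨u, hu⟩ := hu1.exists_left_inv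
  obtain ⟨v, hv⟩ := hu2.exists_left_inv
  have hcA := mpo_laxCentre_commute (N := n + 2) hrr hee hu b
  have hcB := mpo_laxShift_commute (N := n + 2) hrr hee hv b
  have hA0 : mpo (twistHalf b) (fun _ : Fin (n + 2) => laxCentre (inl y : ℂ[ε]) (inl r) 0) =
      (A.map fst).map (inl : ℂ → ℂ[ε]) := by
    refine Eq.trans ?_ (map_fst_mpo_lax_map_inl _ _ _ _ _ _).symm
    congr 2
    simp [laxCentre]
  have hB0 : mpo (twistHalf b) (fun _ : Fin (n + 2) => laxShift (inl y : ℂ[ε]) (inl r) 0) =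
      (B.map fst).map (inl : ℂ → ℂ[ε]) := by
    refine Eq.trans ?_ (map_fst_mpo_lax_map_inl _ _ _ _ _ _).symm
    congr 2
    simp [laxShift]
  rw [hT, hA0] at hcA
  rw [hT, hB0] at hcB
  obtain ⟨haT, haT'⟩ := commute_of_map_inl_mul hcA
  obtain ⟨hbT, hbT'⟩ := commute_of_map_inl_mul hcB
  obtain ⟨hPa, hPa'⟩ := tensorOp_siteParity_mul_map (n + 2) b (1 + ε * inl y) (2 * ε)
    (-1 + ε * inl y) (inl r)
  obtain ⟨hPb, hPb'⟩ := tensorOp_siteParity_mul_map (n + 2) b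
    (inl y + ε * (inl y ^ 2 - 2)) (1 + ε * inl y) (2 * ε) (inl r)
  have hSH := two_smul_twistedShift_mul_hamiltonian (n := n) (twistOne_mul_self b) hε hε' x
  set a₀ := A.map fst
  set a₁ := A.map snd
  set b₀ := B.map fst
  set b₁ := B.map snd
  change P * a₀ = -(a₀ * P) at hPa
  change P * a₁ = -(a₁ * P) at hPa'
  change P * b₀ = -(b₀ * P) at hPb
  change P * b₁ = -(b₁ * P) at hPb'
  change (2 : ℂ) • (S * H) = D + (2 * (n + 2 : ℂ)) • S at hSH
  have hS : IsUnit S := isUnit_twistedShift (twistOne_mul_self b)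
  have hyN : y ^ (n + 2) ≠ 0 := pow_ne_zero _ hy0
  have haS : a₀ * S = S * a₀ := by
    rw [Matrix.mul_smul, Matrix.smul_mul] at haT
    exact smul_right_injective _ hyN haT
  have hbS : b₀ * S = S * b₀ := by
    rw [Matrix.mul_smul, Matrix.smul_mul] at hbT
    exact smul_right_injective _ hyN hbT
  have haD : a₀ * D = D * a₀ := by
    rw [Matrix.mul_smul, Matrix.smul_mul] at haT'
    exact smul_right_injective _ (mul_ne_zero hyN (inv_ne_zero hy0)) haT'
  have hbD : b₀ * D = D * b₀ := by
    rw [Matrix.mul_smul, Matrix.smul_mul] at hbT'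
    exact smul_right_injective _ (mul_ne_zero hyN (inv_ne_zero hy0)) hbT'
  have hcomm : ∀ a, a * S = S * a → a * D = D * a → a * H = H * a := by
    intro a h1 h2
    have h3 : a * ((2 : ℂ) • (S * H)) = (2 : ℂ) • (S * H) * a := by
      rw [hSH, mul_add, add_mul, h2, Matrix.mul_smul, h1, Matrix.smul_mul]
    rw [Matrix.mul_smul, Matrix.smul_mul] at h3
    have h4 : S * (a * H) = S * (H * a) := by
      rw [← Matrix.mul_assoc, ← h1, Matrix.mul_assoc, ← Matrix.mul_assoc S]
      exact smul_right_injective _ two_ne_zero h3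
    exact hS.mul_left_cancel h4
  -- The coefficient `2 (n + 2) / y` of `Y` serves two ends: it supplies the multiple of `S` in `2 S
  -- H`, and it cancels the scalar in `X` against the one in `Y`.
  have hkey : ∀ Y X : Op (n + 2), Y = y ^ (n + 2) • S - (-y) ^ (n + 1 + 1) • 1 →
      X = (y ^ (n + 2) * y⁻¹) • D - (2 * ((n + 1 : ℕ) + 1) * (-y) ^ (n + 1)) • 1 →
      S * H = (y / (2 * y ^ (n + 2))) • (X + (2 * (n + 2) * y⁻¹) • Y) := by
    intro Y X hY hX
    have h2 : S * H = (1 / 2 : ℂ) • (D + (2 * (n + 2 : ℂ)) • S) := by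
      rw [← hSH, smul_smul]
      norm_num
    rw [h2, hY, hX]
    ext i j
    simp only [Matrix.smul_apply, Matrix.add_apply, Matrix.sub_apply, smul_eq_mul]
    push_cast
    field_simp
    ring
  have hab := hkey _ _ hab0 hab1
  have hba := hkey _ _ hba0 hba1
  have hneg : ∀ a b : Op (n + 2), P * a = -(a * P) → P * b = -(b * P) →
      P * (a * b) = a * b * P := by
    intro a b ha hb
    rw [← Matrix.mul_assoc, ha, Matrix.neg_mul, Matrix.mul_assoc, hb, Matrix.mul_neg, neg_neg,
      Matrix.mul_assoc]
  have hPSH : P * (S * H) = S * H * P := by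
    rw [hab]
    simp only [Matrix.mul_smul, Matrix.smul_mul, mul_add, add_mul, hneg _ _ hPa hPb',
      hneg _ _ hPa' hPb, hneg _ _ hPa hPb]
  -- `S` differs from a multiple of `a₀ b₀` by a scalar, and `P` commutes with a product of two
  -- factors that it anticommutes with.
  have hPS : P * S = S * P := by
    have h := hneg _ _ hPa hPb
    rw [hab0, mul_sub, sub_mul, Matrix.mul_smul, Matrix.smul_mul, Matrix.mul_smul, Matrix.smul_mul,
      Matrix.mul_one, Matrix.one_mul, sub_left_inj] at h
    exact smul_right_injective _ hyN h
  refine ⟨?_, trace_mul_pow_succ_eq_zero hS hPa hPb haS hbS (hcomm _ haS haD) (hcomm _ hbS hbD)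
    hab hba⟩
  refine hS.mul_left_cancel ?_
  rw [← Matrix.mul_assoc, ← hPS, Matrix.mul_assoc, hPSH, Matrix.mul_assoc]

end Moments

/-! ### Hermiticity, the limit `x = 0`, and the two boundary conditions. -/

section Main

variable {n : ℕ}

theorem siteOp_conjTranspose {N : ℕ} (j : Fin N) (A : Matrix (Fin 3) (Fin 3) ℂ) :
    (siteOp j A).conjTranspose = siteOp j A.conjTranspose := by
  ext σ τ
  simp only [siteOp, tensorOp, Matrix.conjTranspose_apply, Matrix.of_apply, star_prod]
  refine Finset.prod_congr rfl fun k _ => ?_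
  by_cases hk : k = j
  · subst hk
    simp [Matrix.conjTranspose_apply]
  · simp only [Function.update_of_ne hk]
    rw [← Matrix.conjTranspose_apply, Matrix.conjTranspose_one]

theorem siteOp_mul_nextOp_conjTranspose {K : Matrix (Fin 3) (Fin 3) ℂ}
    (hK : K.conjTranspose = K) (j : Fin (n + 2)) (A B : Matrix (Fin 3) (Fin 3) ℂ) :
    (siteOp j A * nextOp K j B).conjTranspose =
      siteOp j A.conjTranspose * nextOp K j B.conjTranspose := by
  rw [Matrix.conjTranspose_mul, siteOp_conjTranspose]
  unfold nextOp
  split_ifs with h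
  · rw [siteOp_conjTranspose]
    refine siteOp_commute (fun e => ?_) _ _
    have := congrArg Fin.val e
    simp at this
  · rw [siteOp_conjTranspose, Matrix.conjTranspose_mul, Matrix.conjTranspose_mul, hK,
      ← Matrix.mul_assoc]
    -- With at least two sites, the last site and the site `0` are distinct.
    refine siteOp_commute (fun e => ?_) _ _
    rw [← e] at h
    simp at h

theorem spin_conjTranspose : ∀ a, (spin a).conjTranspose = spin a := by
  simp [forall_fin_three, spin_zero, spin_one, spin_two, ← Matrix.ext_iff]

theorem twistOne_conjTranspose (b : Bool) :
    (twistOne b : Matrix _ _ ℂ).conjTranspose = twistOne b := by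
  cases b <;> simp [forall_fin_three, twistOne, ← Matrix.ext_iff]

/-- Taking adjoints turns `s^a s^b` into `s^b s^a` on both sites, and the symmetry of `A` restores
the sum. -/
theorem hamiltonian_isHermitian {K : Matrix (Fin 3) (Fin 3) ℂ} (hK : K * K = 1)
    (hK' : K.conjTranspose = K) {ε : Fin 3 → ℝ}
    (hε : ∀ a, K * spin a * K = ((ε a : ℝ) : ℂ) • spin a)
    (hε' : ∀ a, ε a * ε a = 1) (x : ℝ) : (hamiltonian (n + 2) x ε).IsHermitian := by
  have hs : ∀ a, (spin a ^ 2).conjTranspose = spin a ^ 2 := fun a => by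
    rw [Matrix.conjTranspose_pow, spin_conjTranspose]
  have hs2 : ∀ a b, (spin a * spin b).conjTranspose = spin b * spin a := fun a b => by
    rw [Matrix.conjTranspose_mul, spin_conjTranspose, spin_conjTranspose]
  rw [Matrix.IsHermitian, hamiltonian_eq hK hε hε', Matrix.conjTranspose_sum]
  refine Finset.sum_congr rfl fun j _ => ?_
  rw [Matrix.conjTranspose_sub, Matrix.conjTranspose_sum, Matrix.conjTranspose_sum]
  refine congrArg₂ (· - ·) (Finset.sum_congr rfl fun a _ => ?_) ?_
  · rw [Matrix.conjTranspose_smul, Matrix.conjTranspose_add, Matrix.conjTranspose_add,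
      siteOp_mul_nextOp_conjTranspose hK', siteOp_mul_nextOp_conjTranspose hK',
      siteOp_mul_nextOp_conjTranspose hK', hs, spin_conjTranspose, Matrix.conjTranspose_one,
      RCLike.star_def, Complex.conj_ofReal]
  · refine Eq.trans (Finset.sum_congr rfl fun a _ => ?_) Finset.sum_comm
    rw [Matrix.conjTranspose_sum]
    refine Finset.sum_congr rfl fun b _ => ?_
    rw [Matrix.conjTranspose_smul, siteOp_mul_nextOp_conjTranspose hK', hs2, coupA_symm,
      RCLike.star_def, Complex.conj_ofReal]

theorem continuous_hamiltonian (N : ℕ) (ε : Fin 3 → ℝ) :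
    Continuous fun x => hamiltonian N x ε := by
  have hJ : ∀ a, Continuous fun x => (coupJ x a : ℂ) := by
    rw [forall_fin_three]
    simp only [coupJ]
    and_intros <;> simp <;> fun_prop
  have hA : ∀ a b, Continuous fun x => (coupA x a b : ℂ) := by
    simp only [forall_fin_three, coupA]
    and_intros <;> simp <;> fun_prop
  unfold hamiltonian
  refine continuous_finsetSum _ fun j _ => Continuous.sub ?_ ?_
  · exact continuous_finsetSum _ fun a _ => (hJ a).smul continuous_const
  · exact continuous_finsetSum _ fun a _ => continuous_finsetSum _ fun b _ =>
      (hA a b).smul continuous_const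

/-- Both claims are equalities of continuous functions of `x`, so they extend from the dense set `x
≠ 0`. -/
theorem tensorOp_siteParity_mul_hamiltonian (b : Bool) {ε : Fin 3 → ℝ}
    (hε : ∀ a, twistOne b * spin a * twistOne b = ((ε a : ℝ) : ℂ) • spin a)
    (hε' : ∀ a, ε a * ε a = 1) (x : ℝ) :
    let P : Op (n + 2) := tensorOp fun _ => siteParity b
    let H := hamiltonian (n + 2) x ε
    P * H = H * P ∧ ∀ k : ℕ, (P * H ^ (k + 1)).trace = 0 := by
  intro P H
  have hc := continuous_hamiltonian (n + 2) ε
  have hd : Dense ({0}ᶜ : Set ℝ) := dense_compl_singleton 0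
  refine ⟨?_, fun k => ?_⟩
  · have h := Continuous.ext_on hd (f := fun x => P * hamiltonian (n + 2) x ε)
      (g := fun x => hamiltonian (n + 2) x ε * P) (by fun_prop) (by fun_prop) fun y hy =>
        (tensorOp_siteParity_mul_hamiltonian_of_ne_zero b hε hε' hy).1
    exact congrFun h x
  · have h := Continuous.ext_on hd (f := fun x => (P * hamiltonian (n + 2) x ε ^ (k + 1)).trace)
      (g := fun _ => (0 : ℂ)) (Continuous.matrix_trace (by fun_prop)) continuous_const fun y hy =>
        (tensorOp_siteParity_mul_hamiltonian_of_ne_zero b hε hε' hy).2 k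
    exact congrFun h x

theorem sameNonzeroSpectrum_hamiltonian (b : Bool) {ε : Fin 3 → ℝ}
    (hε : ∀ a, twistOne b * spin a * twistOne b = ((ε a : ℝ) : ℂ) • spin a)
    (hε' : ∀ a, ε a * ε a = 1) (x : ℝ) :
    SameNonzeroSpectrum (hamiltonian (n + 2) x ε) (tensorOp fun _ => siteParity b) := by
  obtain ⟨hPH, htr⟩ := tensorOp_siteParity_mul_hamiltonian (n := n) b hε hε' x
  have hinv : ∀ c : ℂ, ∀ v ∈ sector (tensorOp fun _ : Fin (n + 2) => siteParity b) c,
      Matrix.toLin' (hamiltonian (n + 2) x ε) v ∈ sector (tensorOp fun _ => siteParity b) c := by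
    intro c v hv
    rw [sector, Module.End.mem_eigenspace_iff, Matrix.toLin'_apply] at hv ⊢
    rw [Matrix.toLin'_apply, Matrix.mulVec_mulVec, hPH, ← Matrix.mulVec_mulVec, hv,
      Matrix.mulVec_smul]
  refine ⟨hinv 1, hinv (-1), fun E hE => ?_⟩
  refine finrank_eigenspace_restrict_eq (hamiltonian_isHermitian (twistOne_mul_self b)
    (twistOne_conjTranspose b) hε hε' x) ?_ hPH htr (hinv 1) (hinv (-1)) hE
  rw [tensorOp_mul]
  simp only [siteParity_mul_self, tensorOp_one]

theorem twistOne_true_mul_spin_mul : ∀ a, twistOne true * spin a * twistOne true =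
    ((antidiagTwist a : ℝ) : ℂ) • spin a := by
  simp [forall_fin_three, twistOne, spin_zero, spin_one, spin_two, antidiagTwist, ← Matrix.ext_iff]

theorem twistOne_false_mul_spin_mul : ∀ a, twistOne false * spin a * twistOne false =
    ((diagTwist a : ℝ) : ℂ) • spin a := by
  simp [forall_fin_three, twistOne, spin_zero, spin_one, spin_two, diagTwist, ← Matrix.ext_iff]

theorem neg_one_zpow_sum {ι : Type*} (s : Finset ι) (f : ι → ℤ) :
    (-1 : ℂ) ^ (∑ i ∈ s, f i) = ∏ i ∈ s, (-1 : ℂ) ^ f i := by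
  classical
  induction s using Finset.induction_on with
  | empty => simp
  | insert a s ha ih =>
    rw [Finset.sum_insert ha, Finset.prod_insert ha, zpow_add₀ (by norm_num), ih]

theorem parity_eq_tensorOp (N : ℕ) : parity N = tensorOp fun _ => siteParity true := by
  have h : ∀ s t, (siteParity true s t : ℂ) = if s = t then (-1) ^ siteMag s else 0 := by
    simp [forall_fin_three, siteParity, siteMag]
  ext σ τ
  simp only [parity, tensorOp, Matrix.of_apply, h, Finset.prod_ite_zero, Matrix.diagonal_apply,
    funext_iff, Finset.mem_univ, true_implies]
  congr 1
  exact neg_one_zpow_sum _ _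

end Main

end SpinOneXXZ

theorem mainTheorem11 (N : ℕ) (hN : 2 ≤ N) (x : ℝ) :
    SpinOneXXZ.SameNonzeroSpectrum
        (SpinOneXXZ.hamiltonian N x SpinOneXXZ.antidiagTwist) (SpinOneXXZ.parity N) ∧
      SpinOneXXZ.SameNonzeroSpectrum
        (SpinOneXXZ.hamiltonian N x SpinOneXXZ.diagTwist) (SpinOneXXZ.spinFlip N) := by
  obtain ⟨n, rfl⟩ := Nat.exists_eq_add_of_le' hN
  rw [SpinOneXXZ.parity_eq_tensorOp]
  -- `parity` had to be rewritten as a tensor product, whereas `spinFlip` agrees by definition with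
  -- that of `siteParity false`.
  exact ⟨SpinOneXXZ.sameNonzeroSpectrum_hamiltonian true SpinOneXXZ.twistOne_true_mul_spin_mul
      (by simp [SpinOneXXZ.forall_fin_three, SpinOneXXZ.antidiagTwist]) x,
    SpinOneXXZ.sameNonzeroSpectrum_hamiltonian false SpinOneXXZ.twistOne_false_mul_spin_mul
      (by simp [SpinOneXXZ.forall_fin_three, SpinOneXXZ.diagTwist]) x⟩
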